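/- A CNF formula is a finite set of clauses, each clause being a finite set of literals; $V(G)$ denotes the set of variables appearing in $G$, and $\mathrm{SAT}$ is the set of satisfiable CNF formulas. For a set $S$ of variables and $a_S:S\to\{\text{True},\text{False}\}$, the formula $G[a_S]$ is obtained from $G$ by removing all clauses that contain a literal made true by $a_S$ and deleting from the remaining clauses the literals made false by $a_S$. The unit propagation subsolver works as follows on a formula $F$: if $\emptyset\in F$ it proclaims $F$ unsatisfiable; if $F=\emptyset$ it declares $F$ satisfiable; otherwise it takes the unit clause $\{\ell\}$ of $F$ whose encoding is lexicographically least, makes $\ell$ true, simplifies, and continues with the resulting formula; if there is no unit clause it rejects (makes no statement). It determines $F$ if it returns a satisfying assignment in case $F$ is satisfiable and proclaims unsatisfiability in case $F$ is unsatisfiable. A strong unit-propagation backdoor of $G$ is a nonempty set $S\subseteq V(G)$ such that, for every $a_S:S\to\{\text{True},\text{False}\}$, the unit propagation subsolver determines $G[a_S]$. Formulas are encoded as binary strings, and NP-completeness is with respect to polynomial-time many-one reductions. For a set $A$ of CNF formulas and a function $b:\mathbb N\to\mathbb R$, say that $A$ is a *$b$-backdoor family* if (a) $A\in\mathrm P$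 and $A\cap\mathrm{SAT}$ is NP-complete; (b) each $G\in A$ has a strong unit-propagation backdoor $S$ with $\|S\|\le b(\|V(G)\|)$; and (c) there is a polynomial-time algorithm that, given $G\in A$, finds such a backdoor. Then the following hold. 1. (Constant case) If for some $k\in\{1,2,3,\dots\}$ there is a $b$-backdoor family with $b(n)=k$ for all $n$, then $\mathrm P=\mathrm{NP}$. 2. (Polylogarithmic case) If there are a function $s$ with $s(n)=(\log n)^{O(1)}$ (i.e., for some $c$, $s(n)\le(\log n)^c$ for all sufficiently large $n$) and an $s$-backdoor family, then $\mathrm{NP}$ is contained in quasipolynomial time: $$\mathrm{NP}\subseteq\bigcup_{c>0}\mathrm{DTIME}\bigl[2^{(\log n)^c}\bigr].$$ 3. (Subpolynomial case) If there are a polynomial-time computable function $r:\{0,1\}^*\to\mathbb N$ with $r(0^n)=O(n^{1/k})$ for every $k\in\{1,2,3,\dots\}$ and a $b$-backdoor family with $b(n)=r(0^n)$, then $\mathrm{NP}$ is contained in subexponential time: $$\mathrm{NP}\subseteq\bigcap_{\epsilon>0}\mathrm{DTIME}\bigl[2^{n^\epsilon}\bigr].$$ -/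

import Mathlib

namespace SatBackdoor

open Turing Computability

/-! ### Strings and encodings

All languages are sets of binary strings. -/

abbrev Str := List Bool

/-- Self-delimiting form of a string: each bit is preceded by `true`, and `false` ends it. -/
def block (x : Str) : Str := x.flatMap (fun b => [true, b]) ++ [false]

/-- The encoding of a pair of strings as one string. -/
def pairStr (x w : Str) : Str := block x ++ w

/-- The encoding of a list of strings as one string. -/
def encodeStrList (l : List Str) : Str := l.flatMap block

/-- The encoding of a finite set of strings: its elements, listed in lexicographic order. -/
def encodeStrSet (s : Finset Str) : Str := encodeStrList (s.sort (· ≤ ·))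

/-! ### Complexity classes

The machine model is Mathlib's `Turing.FinTM2` (multi-tape Turing machines, the tapes being
stacks), with Mathlib's count of steps. -/

/-- `f : α → β` is computable in polynomial time, with inputs and outputs encoded by `ea`, `eb`. -/
def PolyTime {α β : Type} (ea : α → Str) (eb : β → Str) (f : α → β) : Prop :=
  Nonempty (TM2ComputableInPolyTime ea eb f)

/-- The class P. -/
def ClassP : Set (Set Str) :=
  {L | ∃ f : Str → Bool, (∀ x, f x = true ↔ x ∈ L) ∧ PolyTime id encodeBool f}

/-- The class NP: polynomially bounded witnesses, checked in polynomial time. -/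
def ClassNP : Set (Set Str) :=
  {L | ∃ R ∈ ClassP, ∃ p : Polynomial ℕ, ∀ x,
    x ∈ L ↔ ∃ w : Str, w.length ≤ p.eval x.length ∧ pairStr x w ∈ R}

/-- The class `DTIME[T]`: languages decided by a deterministic machine
in `O(T(n))` steps on inputs of length `n`. -/
def DTIME (T : ℕ → ℝ) : Set (Set Str) :=
  {L | ∃ f : Str → Bool, (∀ x, f x = true ↔ x ∈ L) ∧
    ∃ (M : TM2ComputableInTime (id : Str → Str) encodeBool f) (C : ℝ),
      ∀ n, (M.time n : ℝ) ≤ C * T n + C}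

/-- Polynomial-time many-one reducibility. -/
def PolyReducible (L L' : Set Str) : Prop :=
  ∃ f : Str → Str, PolyTime id id f ∧ ∀ x, x ∈ L ↔ f x ∈ L'

def NPComplete (L : Set Str) : Prop :=
  L ∈ ClassNP ∧ ∀ L' ∈ ClassNP, PolyReducible L' L

/-! ### CNF formulas -/

/-- A literal: a variable (a natural number) and its sign, `true` for the positive literal. -/
abbrev Lit := ℕ × Bool

/-- A clause is a finite set of literals. -/
abbrev Clause := Finset Lit

/-- A CNF formula is a finite set of clauses. -/
abbrev CNF := Finset Clause

/-- The set `V(F)` of variables that appear in `F`. -/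
def vars (F : CNF) : Finset ℕ := F.biUnion fun C => C.image Prod.fst

/-- The assignment `a` makes a literal of every clause of `F` true. -/
def Satisfies (a : ℕ → Bool) (F : CNF) : Prop := ∀ C ∈ F, ∃ l ∈ C, a l.1 = l.2

def SAT : Set CNF := {F | ∃ a, Satisfies a F}

/-- The formula `F[a_S]`, where `a_S` is the restriction of `a` to the set `S` of variables:
clauses with a true literal are removed, and so are the false literals of the other clauses. -/
def assign (F : CNF) (S : Finset ℕ) (a : ℕ → Bool) : CNF :=
  (F.filter fun C => ∀ l ∈ C, l.1 ∈ S → a l.1 ≠ l.2).image fun C => C.filter fun l => l.1 ∉ S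

/-- The sign of a literal, followed by its variable in binary. -/
def encodeLit (l : Lit) : Str := l.2 :: encodeNat l.1

def encodeClause (C : Clause) : Str := encodeStrSet (C.image encodeLit)

def encodeCNF (F : CNF) : Str := encodeStrSet (F.image encodeClause)

/-- The encoding of a finite set of variables. -/
def encodeVars (S : Finset ℕ) : Str := encodeStrSet (S.image encodeNat)

/-- The language of the encodings of the formulas in `A`. -/
def lang (A : Set CNF) : Set Str := encodeCNF '' A

/-! ### Subsolvers, the unit propagation subsolver, strong backdoors -/

/-- The answer of a subsolver. -/
inductive Outcome where
  /-- no statement is made -/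
  | reject
  /-- satisfiable, with a satisfying assignment (values of variables outside of the formula are
  irrelevant) -/
  | sat (a : ℕ → Bool)
  /-- unsatisfiable -/
  | unsat

/-- The subsolver `B` determines `F`: it returns a satisfying assignment if `F` is satisfiable,
and it proclaims unsatisfiability if `F` is unsatisfiable. -/
def Determines (B : CNF → Outcome) (F : CNF) : Prop :=
  (F ∈ SAT ∧ ∃ a, B F = .sat a ∧ Satisfies a F) ∨ (F ∉ SAT ∧ B F = .unsat)

/-- `S` is a strong backdoor of `F` for the subsolver `B`. -/
def IsStrongBackdoor (B : CNF → Outcome) (F : CNF) (S : Finset ℕ) : Prop :=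
  S.Nonempty ∧ S ⊆ vars F ∧ ∀ a : ℕ → Bool, Determines B (assign F S a)

/-- The literals `l` such that `{l}` is a (unit) clause of `F`. -/
def unitLits (F : CNF) : Finset Lit := (F.biUnion id).filter fun l => {l} ∈ F

/-- The literal in the unit clause of `F` whose encoding is lexicographically least
(`none` if `F` has no unit clause). -/
noncomputable def leastUnit (F : CNF) : Option Lit :=
  (unitLits F).toList.argmin fun l => encodeClause {l}

theorem mem_of_leastUnit {F : CNF} {l : Lit} (h : leastUnit F = some l) : {l} ∈ F := by
  have h1 := List.argmin_mem (f := fun l : Lit => encodeClause {l}) (l := (unitLits F).toList)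
    (m := l) h
  rw [Finset.mem_toList] at h1
  exact (Finset.mem_filter.1 h1).2

theorem vars_assign_subset (F : CNF) (S : Finset ℕ) (a : ℕ → Bool) :
    vars (assign F S a) ⊆ vars F \ S := by
  intro x hx
  simp only [vars, assign, Finset.mem_biUnion, Finset.mem_image, Finset.mem_filter] at hx
  obtain ⟨_, ⟨C, ⟨hC, -⟩, rfl⟩, l, hl, rfl⟩ := hx
  rw [Finset.mem_filter] at hl
  exact Finset.mem_sdiff.2
    ⟨Finset.mem_biUnion.2 ⟨C, hC, Finset.mem_image_of_mem _ hl.1⟩, hl.2⟩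

theorem card_vars_assign_lt {F : CNF} {l : Lit} (h : leastUnit F = some l) (a : ℕ → Bool) :
    (vars (assign F {l.1} a)).card < (vars F).card := by
  have hl : l.1 ∈ vars F := Finset.mem_biUnion.2
    ⟨{l}, mem_of_leastUnit h, Finset.mem_image_of_mem _ (Finset.mem_singleton_self l)⟩
  refine Finset.card_lt_card (Finset.ssubset_iff_subset_ne.2
    ⟨(vars_assign_subset F _ a).trans Finset.sdiff_subset, fun he => ?_⟩)
  have h2 := vars_assign_subset F {l.1} a (he.symm ▸ hl)
  simp at h2

/-- The unit propagation subsolver: empty clause detection, and repeated simplification by the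
literal in the least unit clause. -/
noncomputable def unitPropagation (F : CNF) : Outcome :=
  if ∅ ∈ F then .unsat
  else if F = ∅ then .sat fun _ => false
  else
    match _h : leastUnit F with
    | none => .reject
    | some l =>
      match unitPropagation (assign F {l.1} fun _ => l.2) with
      | .sat a => .sat (Function.update a l.1 l.2)
      | .unsat => .unsat
      | .reject => .reject
termination_by (vars F).card
decreasing_by exact card_vars_assign_lt ‹_› _

/-- `S` is a strong backdoor of `G` with respect to the unit propagation subsolver,
of size at most `b(‖V(G)‖)`. -/
def IsSmallBackdoor (b : ℕ → ℝ) (G : CNF) (S : Finset ℕ) : Prop :=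
  IsStrongBackdoor unitPropagation G S ∧ (S.card : ℝ) ≤ b (vars G).card

/-- There is a polynomial-time algorithm that, given `G ∈ A`, finds a set `S` of variables
with `Q G S`. (Nothing is required of the algorithm on other inputs.) -/
def FoundInPolyTime (A : Set CNF) (Q : CNF → Finset ℕ → Prop) : Prop :=
  ∃ f : A → Finset ℕ, (∀ G : A, Q G (f G)) ∧
    PolyTime (fun G : A => encodeCNF G) encodeVars f

end SatBackdoor

open SatBackdoor

/-! Let `L` be in NP. Reduce `x` to the formula `G` encoded by `g x`, where `g` reduces `L` to `lang
(A ∩ SAT)`. If `g x` does not encode a formula of `A`, reject. Otherwise find a small backdoor `S`,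
run unit propagation under each of the `2 ^ |S|` assignments to `S`, and accept if one run produces
a satisfying assignment. The time is polynomial in `|x| + 2 ^ |S|`. Since `G` has at most `(|x| + 2)
^ k` variables for a fixed `k`, what remains is to compose the bound `b` with a polynomial. A
constant stays constant, a power of `log` stays polylogarithmic, and `n ^ (1/j)` with `j` large
compared with `k / ε` is still below `n ^ (ε/2)`.

The order in which the subsolver picks unit clauses need not be simulated. The algorithm saturates
instead: it keeps a list `T` of literals and repeatedly goes through all clauses of `G`, adding each
literal whose companions in some clause are falsified by `T`. Acceptance certifies itself: a
consistent `T` that meets every clause gives a satisfying assignment. Conversely, if `a` satisfies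
`G`, start with the values of `a` on `S`. Everything derived is then true under `a`, so `T` stays
consistent; and the restricted formula is satisfiable, so the backdoor property makes the subsolver
succeed on it, and saturation derives at least what the subsolver derives
(`exists_mem_iterate_pass`). This gives `decides_iff`.

The other half is to realise this on Turing machines within the time bound. Program fragments with
four string registers that call given machines yield composition, pairing, case distinction and
while loops (`exists_comp`, `exists_pair`, `exists_cond`, `exists_while`). These become closure
properties of `Feasible`, notably `Feasible.foldl`, and the decision procedure is written entirely
with folds. The budget in `Feasible` pays for the `2 ^ |S|` assignments, so one proof serves all
three cases (`exists_feasible_decision`). -/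

namespace SatBackdoor

open Turing Computability

/-! ### Runs of transition systems with a bound on the number of steps -/

/-- `Reach f a b t`: the partial function `f` leads from `a` to `b` in at most `t` steps. -/
inductive Reach {X : Type*} (f : X → Option X) : X → X → ℕ → Prop
  | refl (a t) : Reach f a a t
  | head {a b c t} : f a = some b → Reach f b c t → Reach f a c (t + 1)

namespace Reach

variable {X : Type*} {f : X → Option X} {a b c : X} {t t' : ℕ}

theorem mono (h : Reach f a b t) (ht : t ≤ t') : Reach f a b t' := by
  induction h generalizing t' with
  | refl a t => exact refl a t'
  | head h1 _ ih =>
    obtain ⟨t', rfl⟩ := Nat.exists_eq_add_of_le' (Nat.le_of_add_left_le ht)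
    exact head h1 (ih (by omega))

theorem trans (h : Reach f a b t) (h' : Reach f b c t') : Reach f a c (t + t') := by
  induction h with
  | refl a t => exact h'.mono (by omega)
  | head h1 _ ih => exact (head h1 (ih h')).mono (by omega)

theorem single (h : f a = some b) : Reach f a b 1 := head h (refl b 0)

/-- Mathlib counts steps by iterating the step function lifted to `Option`; this lemma and `iterate`
translate between the two counts. -/
theorem of_iterate {n : ℕ} (h : (flip bind f)^[n] (some a) = some b) : Reach f a b n := by
  induction n generalizing a with
  | zero =>
    cases h
    exact refl _ _
  | succ n ih =>
    rw [Function.iterate_succ_apply] at h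
    change (flip bind f)^[n] (f a) = some b at h
    cases hf : f a with
    | none =>
      rw [hf] at h
      -- A run that has stopped stays at `none`, so it cannot arrive at `some b` later.
      have : ∀ n, (flip bind f)^[n] none = none := fun n => by
        induction n with
        | zero => rfl
        | succ n ih => rw [Function.iterate_succ_apply]; exact ih
      rw [this] at h
      cases h
    | some x =>
      rw [hf] at h
      exact head hf (ih h)

theorem iterate (h : Reach f a b t) : ∃ n ≤ t, (flip bind f)^[n] (some a) = some b := by
  induction h with
  | refl a t => exact ⟨0, Nat.zero_le _, rfl⟩
  | head h1 _ ih =>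
    obtain ⟨n, hn, h⟩ := ih
    refine ⟨n + 1, by omega, ?_⟩
    rw [Function.iterate_succ_apply, ← h]
    exact congrArg _ h1

end Reach

/-! ### String machines -/

/-- The machine `M` outputs `y` on the input `x` in at most `t` steps. -/
def Comp (M : TM2ComputableAux Bool Bool) (x y : Str) (t : ℕ) : Prop :=
  Reach M.tm.step (initList M.tm (x.map M.inputAlphabet.symm))
    (haltList M.tm (y.map M.outputAlphabet.symm)) t

theorem Comp.mono {M x y t t'} (h : Comp M x y t) (ht : t ≤ t') : Comp M x y t' :=
  Reach.mono h ht

theorem comp_iff {M x y t} : Comp M x y t ↔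
    Nonempty (TM2OutputsInTime M.tm (x.map M.inputAlphabet.invFun)
      (some (y.map M.outputAlphabet.invFun)) t) := by
  constructor
  · intro h
    obtain ⟨n, hn, h⟩ := Reach.iterate h
    exact ⟨⟨⟨n, h⟩, hn⟩⟩
  · rintro ⟨⟨⟨n, h⟩, hn⟩⟩
    exact (Reach.of_iterate h).mono hn

/-! ### The length of the output -/

section Length

variable {K : Type} [DecidableEq K] {Γ : K → Type} {Λ σ : Type}

/-- The number of push instructions of a statement. -/
def pushes : TM2.Stmt Γ Λ σ → ℕ
  | .push _ _ q => pushes q + 1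
  | .peek _ _ q => pushes q
  | .pop _ _ q => pushes q
  | .load _ q => pushes q
  | .branch _ q₁ q₂ => pushes q₁ + pushes q₂
  | .goto _ => 0
  | .halt => 0

/-- The total length of the stacks. -/
def totalLength [Fintype K] (S : ∀ k, List (Γ k)) : ℕ := ∑ k, (S k).length

theorem totalLength_update_le [Fintype K] (S : ∀ k, List (Γ k)) (k : K) (x : List (Γ k)) (d : ℕ)
    (h : x.length ≤ (S k).length + d) :
    totalLength (Function.update S k x) ≤ totalLength S + d := by
  unfold totalLength
  rw [← Finset.add_sum_erase _ _ (Finset.mem_univ k),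
    ← Finset.add_sum_erase Finset.univ (fun k => (S k).length) (Finset.mem_univ k)]
  rw [Finset.sum_congr rfl (g := fun k => (S k).length)]
  · simp only [Function.update_self]
    omega
  · intro j hj
    rw [Function.update_of_ne (Finset.ne_of_mem_erase hj)]

theorem totalLength_stepAux_le [Fintype K] (q : TM2.Stmt Γ Λ σ) (v : σ) (S : ∀ k, List (Γ k)) :
    totalLength (TM2.stepAux q v S).stk ≤ totalLength S + pushes q := by
  induction q generalizing v S with
  | push k f q ih =>
    refine (ih _ _).trans ?_
    have := totalLength_update_le S k (f v :: S k) 1 (by simp)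
    simp only [pushes]
    omega
  | peek k f q ih => exact ih _ _
  | pop k f q ih =>
    refine (ih _ _).trans ?_
    have := totalLength_update_le S k (S k).tail 0 (by simp)
    simp only [pushes]
    omega
  | load f q ih => exact ih _ _
  | branch f q₁ q₂ ih₁ ih₂ =>
    simp only [TM2.stepAux, pushes]
    cases f v
    · exact (ih₂ v S).trans (by omega)
    · exact (ih₁ v S).trans (by omega)
  | goto f => exact le_rfl
  | halt => exact le_rfl

theorem totalLength_le_of_reach [Fintype K] {m : Λ → TM2.Stmt Γ Λ σ} {d : ℕ}
    (hd : ∀ l, pushes (m l) ≤ d) {a b : TM2.Cfg Γ Λ σ} {t : ℕ} (h : Reach (TM2.step m) a b t) :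
    totalLength b.stk ≤ totalLength a.stk + d * t := by
  induction h with
  | refl a t => exact Nat.le_add_right _ _
  | @head a b c t h1 _ ih =>
    obtain ⟨_ | l, v, S⟩ := a
    · cases h1
    · cases h1
      have := totalLength_stepAux_le (m l) v S
      have := hd l
      change _ ≤ totalLength S + _
      rw [Nat.mul_add, Nat.mul_one]
      omega

end Length

theorem totalLength_single {K : Type} [DecidableEq K] [Fintype K] {Γ : K → Type} (k : K)
    (S : ∀ k, List (Γ k)) (h : ∀ j, j ≠ k → S j = []) : totalLength S = (S k).length := by
  refine Finset.sum_eq_single k (fun j _ hj => ?_) (by simp)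
  rw [h j hj]
  rfl

/-- The output of a machine is at most linearly longer than the time and the input. -/
theorem exists_length_le (M : TM2ComputableAux Bool Bool) :
    ∃ d, ∀ x y t, Comp M x y t → y.length ≤ x.length + d * t := by
  let := M.tm.ΛFin
  let := M.tm.kFin
  -- The pushes at all labels together bound the pushes of any single step.
  refine ⟨∑ l : M.tm.Λ, pushes (M.tm.m l), fun x y t h => ?_⟩
  have h1 := totalLength_le_of_reach (K := M.tm.K) (m := M.tm.m)
    (d := ∑ l : M.tm.Λ, pushes (M.tm.m l))
    (fun l => Finset.single_le_sum (f := fun l => pushes (M.tm.m l))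
      (fun _ _ => Nat.zero_le _) (Finset.mem_univ l)) h
  rw [totalLength_single M.tm.k₁, totalLength_single M.tm.k₀] at h1
  · simpa [initList, haltList] using h1
  · intro j hj
    simp [initList, hj]
  · intro j hj
    simp [haltList, hj]

/-! ### Program fragments -/

/-- A part of a program, left by halting. -/
structure Frag {K : Type} (Γ : K → Type) (σ : Type) where
  Λ : Type
  fin : Fintype Λ
  entry : Λ
  m : Λ → TM2.Stmt Γ Λ σ

attribute [instance] Frag.fin

section Map

variable {K : Type} {Γ : K → Type} {Λ Λ' σ : Type}

/-- Renames the labels of a statement and replaces the halting instruction. -/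
def mapStmt (g : Λ → Λ') (q' : TM2.Stmt Γ Λ' σ) : TM2.Stmt Γ Λ σ → TM2.Stmt Γ Λ' σ
  | .push k f q => .push k f (mapStmt g q' q)
  | .peek k f q => .peek k f (mapStmt g q' q)
  | .pop k f q => .pop k f (mapStmt g q' q)
  | .load f q => .load f (mapStmt g q' q)
  | .branch f q₁ q₂ => .branch f (mapStmt g q' q₁) (mapStmt g q' q₂)
  | .goto f => .goto fun v => g (f v)
  | .halt => q'

variable [DecidableEq K]

/-- The effect of `mapStmt` on the configuration after a step. -/
def contCfg (g : Λ → Λ') (q' : TM2.Stmt Γ Λ' σ) : TM2.Cfg Γ Λ σ → TM2.Cfg Γ Λ' σ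
  | ⟨some l, v, S⟩ => ⟨some (g l), v, S⟩
  | ⟨none, v, S⟩ => TM2.stepAux q' v S

theorem stepAux_mapStmt (g : Λ → Λ') (q' : TM2.Stmt Γ Λ' σ) (q : TM2.Stmt Γ Λ σ) (v : σ)
    (S : ∀ k, List (Γ k)) :
    TM2.stepAux (mapStmt g q' q) v S = contCfg g q' (TM2.stepAux q v S) := by
  induction q generalizing v S with
  | push k f q ih => exact ih _ _
  | peek k f q ih => exact ih _ _
  | pop k f q ih => exact ih _ _
  | load f q ih => exact ih _ _
  | branch f q₁ q₂ ih₁ ih₂ =>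
    simp only [mapStmt, TM2.stepAux]
    cases f v
    · exact ih₂ v S
    · exact ih₁ v S
  | goto f => rfl
  | halt => rfl

/-- The statement `q'` that replaces halting is executed within the step that would have halted, so
gluing programs costs no extra step. -/
theorem reach_mapStmt {m : Λ → TM2.Stmt Γ Λ σ} {m' : Λ' → TM2.Stmt Γ Λ' σ} {g : Λ → Λ'}
    {q' : TM2.Stmt Γ Λ' σ} (hm : ∀ l, m' (g l) = mapStmt g q' (m l)) {a b : TM2.Cfg Γ Λ σ} {t : ℕ}
    (h : Reach (TM2.step m) a b t) (hb : b.l = none) :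
    Reach (TM2.step m') (contCfg g q' a) (contCfg g q' b) t := by
  induction h with
  | refl a t => exact .refl _ _
  | @head a b c t h1 _ ih =>
    obtain ⟨_ | l, v, S⟩ := a
    · cases h1
    · cases h1
      refine .head (b := contCfg g q' (TM2.stepAux (m l) v S)) ?_ (ih hb)
      simp only [contCfg, TM2.step, hm, stepAux_mapStmt]

end Map

namespace Frag

variable {K : Type} [DecidableEq K] {Γ : K → Type} {W : Type}

/-- `F.Runs w S S' t`: started on the stacks `S`, the fragment `F` ends with the stacks `S'` after
at most `t` steps. The buffer is arbitrary, the rest `w` of the state is as before. -/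
def Runs (F : Frag Γ (Option Bool × W)) (w : W) (S S' : ∀ k, List (Γ k)) (t : ℕ) : Prop :=
  ∀ o, ∃ o', Reach (TM2.step F.m) ⟨some F.entry, (o, w), S⟩ ⟨none, (o', w), S'⟩ t

variable {F G : Frag Γ (Option Bool × W)} {w : W} {S S' S'' : ∀ k, List (Γ k)} {t t' : ℕ}

theorem Runs.mono (h : F.Runs w S S' t) (ht : t ≤ t') : F.Runs w S S' t' := fun o => by
  obtain ⟨o', h⟩ := h o
  exact ⟨o', h.mono ht⟩

/-- The fragment without effect. -/
def skip : Frag Γ (Option Bool × W) := ⟨Unit, inferInstance, (), fun _ => .halt⟩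

theorem runs_skip : (skip : Frag Γ (Option Bool × W)).Runs w S S 1 :=
  fun o => ⟨o, .single rfl⟩

/-- Pushes a symbol. -/
def push (k : K) (a : Γ k) : Frag Γ (Option Bool × W) :=
  ⟨Unit, inferInstance, (), fun _ => .push k (fun _ => a) .halt⟩

theorem runs_push (k : K) (a : Γ k) :
    (push k a : Frag Γ (Option Bool × W)).Runs w S (Function.update S k (a :: S k)) 1 :=
  fun o => ⟨o, .single rfl⟩

/-- Runs `F`, then `G`. -/
def seq (F G : Frag Γ (Option Bool × W)) : Frag Γ (Option Bool × W) where
  Λ := F.Λ ⊕ G.Λ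
  fin := inferInstance
  entry := .inl F.entry
  m := Sum.elim (fun l => mapStmt .inl (.goto fun _ => .inr G.entry) (F.m l))
    fun l => mapStmt .inr .halt (G.m l)

theorem Runs.seq (h : F.Runs w S S' t) (h' : G.Runs w S' S'' t') :
    (F.seq G).Runs w S S'' (t + t') := fun o => by
  obtain ⟨o', h⟩ := h o
  obtain ⟨o'', h'⟩ := h' o'
  exact ⟨o'', (reach_mapStmt (m' := (F.seq G).m) (fun _ => rfl) h rfl).trans
    (reach_mapStmt (m' := (F.seq G).m) (q' := .halt) (fun _ => rfl) h' rfl)⟩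

/-- Pops from the stack `k` until it is empty, and runs `F b` whenever a symbol standing for the bit
`b` has been popped. -/
def loop (k : K) (e : Γ k → Bool) (F : Bool → Frag Γ (Option Bool × W)) :
    Frag Γ (Option Bool × W) where
  Λ := Option (Σ b, (F b).Λ)
  fin := inferInstance
  entry := none
  m
    | none => .pop k (fun v x => (x.map e, v.2)) (.branch (fun v => v.1.isNone) .halt
        (.goto fun v => some ⟨v.1.getD false, (F _).entry⟩))
    | some ⟨b, l⟩ => mapStmt (fun l => some ⟨b, l⟩) (.goto fun _ => none) ((F b).m l)

variable {k : K} {e : Γ k → Bool} {B : Bool → Frag Γ (Option Bool × W)}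

theorem runs_loop_nil (h : S k = []) : (loop k e B).Runs w S S 1 := fun o => by
  refine ⟨none, .single ?_⟩
  have : Function.update S k [] = S := by rw [← h, Function.update_eq_self]
  simp [loop, h, this]

theorem Runs.loop_cons {a : Γ k} {l : List (Γ k)} (h : S k = a :: l)
    (hB : (B (e a)).Runs w (Function.update S k l) S' t) (hl : (Frag.loop k e B).Runs w S' S'' t') :
    (Frag.loop k e B).Runs w S S'' (t + t' + 1) := fun o => by
  obtain ⟨o', hB⟩ := hB (some (e a))
  obtain ⟨o'', hl⟩ := hl o'
  refine ⟨o'', .head (b := ⟨some (some ⟨e a, (B (e a)).entry⟩), (some (e a), w),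
    Function.update S k l⟩) ?_ (Reach.trans ?_ hl)⟩
  · simp [Frag.loop, h]
  · exact reach_mapStmt (m' := (Frag.loop k e B).m) (g := fun l => some ⟨e a, l⟩) (fun _ => rfl) hB rfl

/-- Pops from the stack `k`, and continues with `F o` if the symbol popped stands for `o`. -/
def case (k : K) (e : Γ k → Bool) (F : Option Bool → Frag Γ (Option Bool × W)) :
    Frag Γ (Option Bool × W) where
  Λ := Option (Σ o, (F o).Λ)
  fin := inferInstance
  entry := none
  m
    | none => .pop k (fun v x => (x.map e, v.2)) (.goto fun v => some ⟨v.1, (F _).entry⟩)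
    | some ⟨o, l⟩ => mapStmt (fun l => some ⟨o, l⟩) .halt ((F o).m l)

theorem Runs.case {C : Option Bool → Frag Γ (Option Bool × W)} {o : Option Bool}
    (ho : (S k).head?.map e = o) (hS : Function.update S k (S k).tail = S')
    (h : (C o).Runs w S' S'' t) : (Frag.case k e C).Runs w S S'' (t + 1) := fun o₁ => by
  subst ho hS
  obtain ⟨o', h⟩ := h ((S k).head?.map e)
  refine ⟨o', .head (b := ⟨some (some ⟨(S k).head?.map e, (C _).entry⟩), ((S k).head?.map e, w),
    Function.update S k (S k).tail⟩) rfl ?_⟩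
  exact reach_mapStmt (m' := (Frag.case k e C).m) (q' := .halt)
    (g := fun l => some ⟨(S k).head?.map e, l⟩) (fun _ => rfl) h rfl

/-- Moves the stack `k` onto the stack `k'`, translating its symbols. -/
theorem runs_loop_push {k' : K} (hk : k ≠ k') (e' : Bool → Γ k') (l : List (Γ k)) (h : S k = l) :
    (loop k e fun b => push k' (e' b)).Runs w S
      (Function.update (Function.update S k []) k' ((l.map fun a => e' (e a)).reverse ++ S k'))
      (2 * l.length + 1) := by
  induction l generalizing S with
  | nil =>
    have : Function.update S k [] = S := by rw [← h, Function.update_eq_self]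
    rw [this, List.map_nil, List.reverse_nil, List.nil_append, Function.update_eq_self]
    exact runs_loop_nil h
  | cons a l ih =>
    have key := Runs.loop_cons h (runs_push k' (e' (e a))) (ih (by simp [hk]))
    rw [Function.update_comm hk.symm] at key
    simp only [Function.update_self, Function.update_idem, Function.update_of_ne hk.symm,
      Function.update_comm hk] at key
    rw [Function.update_comm hk]
    refine Runs.mono (by simpa using key) ?_
    simp only [List.length_cons]
    omega

end Frag

/-! ### Programs with string registers that call machines -/

section Registers

variable {ι : Type} (M : ι → TM2ComputableAux Bool Bool)

/-- The stacks: four registers, and those of the machines `M j`. -/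
abbrev StackIx := Fin 4 ⊕ Σ j, (M j).tm.K

/-- The symbols of the stacks. -/
abbrev Symb : StackIx M → Type
  | .inl _ => Bool
  | .inr p => (M p.1).tm.Γ p.2

/-- The stacks with the registers `s`, the machines `M j` being cleared. -/
def regStacks (s : Fin 4 → Str) : ∀ k, List (Symb M k)
  | .inl r => s r
  | .inr _ => []

/-- The states of the machines `M j`. -/
abbrev HiddenState := ∀ j, (M j).tm.σ

/-- A program with four string registers that calls the machines `M j`. -/
abbrev Prog := Frag (Symb M) (Option Bool × HiddenState M)

variable [DecidableEq ι] {M}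

theorem regStacks_update (s : Fin 4 → Str) (r : Fin 4) (x : Str) :
    regStacks M (Function.update s r x) = Function.update (regStacks M s) (.inl r) x := by
  funext k
  rcases k with r' | p
  · rcases eq_or_ne r' r with rfl | h
    · simp [regStacks]
    · rw [Function.update_of_ne (by simpa using h)]
      simp [regStacks, h]
  · rfl

/-- The machine `M j` as a fragment. -/
def machineFrag (M : ι → TM2ComputableAux Bool Bool) (j : ι) : Prog M where
  Λ := (M j).tm.Λ
  fin := (M j).tm.ΛFin
  entry := (M j).tm.main
  m l := embed ((M j).tm.m l)
where
  embed : TM2.Stmt (M j).tm.Γ (M j).tm.Λ (M j).tm.σ →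
      TM2.Stmt (Symb M) (M j).tm.Λ (Option Bool × HiddenState M)
    | .push k f q => .push (.inr ⟨j, k⟩) (fun v => f (v.2 j)) (embed q)
    | .peek k f q => .peek (.inr ⟨j, k⟩) (fun v x => (v.1, Function.update v.2 j (f (v.2 j) x)))
        (embed q)
    | .pop k f q => .pop (.inr ⟨j, k⟩) (fun v x => (v.1, Function.update v.2 j (f (v.2 j) x)))
        (embed q)
    | .load f q => .load (fun v => (v.1, Function.update v.2 j (f (v.2 j)))) (embed q)
    | .branch f q₁ q₂ => .branch (fun v => f (v.2 j)) (embed q₁) (embed q₂)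
    | .goto f => .goto fun v => f (v.2 j)
    | .halt => .halt

/-- The stacks `S`, where those of the machine `M j` are replaced by `T`. -/
def putStacks (j : ι) (S : ∀ k, List (Symb M k)) (T : ∀ k, List ((M j).tm.Γ k)) :
    ∀ k, List (Symb M k)
  | .inl r => S (.inl r)
  | .inr ⟨i, k⟩ => if h : i = j then by subst h; exact T k else S (.inr ⟨i, k⟩)

@[simp]
theorem putStacks_apply (j : ι) (S : ∀ k, List (Symb M k)) (T : ∀ k, List ((M j).tm.Γ k)) (k) :
    putStacks j S T (.inr ⟨j, k⟩) = T k := by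
  simp [putStacks]

theorem putStacks_update (j : ι) (S : ∀ k, List (Symb M k)) (T : ∀ k, List ((M j).tm.Γ k)) (k x) :
    putStacks j S (Function.update T k x) =
      Function.update (putStacks j S T) (.inr ⟨j, k⟩) x := by
  funext k'
  rcases k' with r | ⟨i, k'⟩
  · rfl
  · by_cases h : i = j
    · subst h
      by_cases hk : k' = k
      · subst hk
        simp
      · rw [Function.update_of_ne (by simpa using hk)]
        simp [hk]
    · rw [Function.update_of_ne (by simp [h])]
      simp [putStacks, h]

/-- A configuration of the machine `M j` as one of the fragment. -/
def putCfg (j : ι) (o : Option Bool) (w : HiddenState M) (S : ∀ k, List (Symb M k))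
    (c : TM2.Cfg (M j).tm.Γ (M j).tm.Λ (M j).tm.σ) :
    TM2.Cfg (Symb M) (M j).tm.Λ (Option Bool × HiddenState M) :=
  ⟨c.l, (o, Function.update w j c.var), putStacks j S c.stk⟩

theorem stepAux_embed (j : ι) (o : Option Bool) (w : HiddenState M) (S : ∀ k, List (Symb M k))
    (q : TM2.Stmt (M j).tm.Γ (M j).tm.Λ (M j).tm.σ) (v T) :
    TM2.stepAux (machineFrag.embed M j q) (o, Function.update w j v) (putStacks j S T) =
      putCfg j o w S (TM2.stepAux q v T) := by
  induction q generalizing v T with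
  | push k f q ih => simp [machineFrag.embed, ← ih, putStacks_update]
  | peek k f q ih => simp [machineFrag.embed, ← ih]
  | pop k f q ih => simp [machineFrag.embed, ← ih, putStacks_update]
  | load f q ih => simp [machineFrag.embed, ← ih]
  | branch f q₁ q₂ ih₁ ih₂ =>
    simp only [machineFrag.embed, TM2.stepAux, Function.update_self]
    cases f v
    · exact ih₂ v T
    · exact ih₁ v T
  | goto f => simp [machineFrag.embed, putCfg]
  | halt => rfl

theorem reach_putCfg (j : ι) (o : Option Bool) (w : HiddenState M) (S : ∀ k, List (Symb M k))
    {a b : TM2.Cfg (M j).tm.Γ (M j).tm.Λ (M j).tm.σ} {t} (h : Reach (TM2.step (M j).tm.m) a b t) :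
    Reach (TM2.step (machineFrag M j).m) (putCfg j o w S a) (putCfg j o w S b) t := by
  induction h with
  | refl a t => exact .refl _ _
  | @head a b c t h1 _ ih =>
    obtain ⟨_ | l, v, T⟩ := a
    · cases h1
    · cases h1
      exact .head (congrArg some (stepAux_embed j o w S _ v T)) ih

/-- The states of the machines `M j` before and after their computations. -/
def hiddenInit (M : ι → TM2ComputableAux Bool Bool) : HiddenState M := fun j => (M j).tm.initialState

/-- The program `F` leads from the register contents `s` to `s'` in at most `t` steps. -/
def Does (F : Prog M) (s s' : Fin 4 → Str) (t : ℕ) : Prop :=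
  F.Runs (hiddenInit M) (regStacks M s) (regStacks M s') t

variable {F G : Prog M} {s s' s'' : Fin 4 → Str} {r r' : Fin 4} {t t' : ℕ}

theorem Does.mono (h : Does F s s' t) (ht : t ≤ t') : Does F s s' t' := Frag.Runs.mono h ht

theorem does_skip : Does (M := M) .skip s s 1 := Frag.runs_skip

theorem Does.seq (h : Does F s s' t) (h' : Does G s' s'' t') : Does (F.seq G) s s'' (t + t') :=
  Frag.Runs.seq h h'

/-- Pushes a bit onto a register. -/
def pushR (M : ι → TM2ComputableAux Bool Bool) (r : Fin 4) (b : Bool) : Prog M := .push (.inl r) b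

theorem does_push (b : Bool) : Does (pushR M r b) s (Function.update s r (b :: s r)) 1 := by
  unfold Does
  rw [regStacks_update]
  exact Frag.runs_push (Γ := Symb M) (.inl r) b

/-- Pops from a register until it is empty, running `B b` whenever `b` has been popped. -/
def loopR (r : Fin 4) (B : Bool → Prog M) : Prog M := .loop (Γ := Symb M) (.inl r) id B

theorem does_loop_nil {B : Bool → Prog M} (h : s r = []) : Does (loopR r B) s s 1 :=
  Frag.runs_loop_nil h

theorem Does.loop_cons {B : Bool → Prog M} {b : Bool} {l : Str} (h : s r = b :: l)
    (hB : Does (B b) (Function.update s r l) s' t) (hl : Does (loopR r B) s' s'' t') :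
    Does (loopR r B) s s'' (t + t' + 1) := by
  unfold Does at hB
  rw [regStacks_update] at hB
  exact Frag.Runs.loop_cons (Γ := Symb M) (k := .inl r) (e := id) h hB hl

/-- Pops from a register and continues depending on the result. -/
def caseR (r : Fin 4) (C : Option Bool → Prog M) : Prog M := .case (Γ := Symb M) (.inl r) id C

theorem Does.case_nil {C : Option Bool → Prog M} (h : s r = []) (hC : Does (C none) s s' t) :
    Does (caseR r C) s s' (t + 1) := by
  have h1 : regStacks M s (.inl r) = [] := h
  refine Frag.Runs.case (Γ := Symb M) (k := .inl r) (e := id) (by rw [h1]; rfl) ?_ hC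
  rw [h1, List.tail_nil, ← h1, Function.update_eq_self]

theorem Does.case_cons {C : Option Bool → Prog M} {b : Bool} {l : Str} (h : s r = b :: l)
    (hC : Does (C (some b)) (Function.update s r l) s' t) : Does (caseR r C) s s' (t + 1) := by
  have h1 : regStacks M s (.inl r) = b :: l := h
  unfold Does at hC
  rw [regStacks_update] at hC
  exact Frag.Runs.case (Γ := Symb M) (k := .inl r) (e := id) (by rw [h1]; rfl) (by rw [h1]; rfl) hC

/-- Moves the register `r` onto `r'`. -/
def moveR (M : ι → TM2ComputableAux Bool Bool) (r r' : Fin 4) : Prog M := loopR r (pushR M r')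

theorem does_move (h : r ≠ r') : Does (moveR M r r') s
    (Function.update (Function.update s r []) r' ((s r).reverse ++ s r')) (2 * (s r).length + 1) := by
  unfold Does
  rw [regStacks_update, regStacks_update]
  have := Frag.runs_loop_push (Γ := Symb M) (k := .inl r) (k' := .inl r') (w := hiddenInit M)
    (S := regStacks M s) (e := id) (by simpa using h) id (s r) rfl
  simp only [id, List.map_id'] at this
  exact this

/-- Replaces the contents of the register `r` by the output of the machine `M j` on it, using the
register `r'`. -/
def callR (M : ι → TM2ComputableAux Bool Bool) (j : ι) (r r' : Fin 4) : Prog M :=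
  (moveR M r r').seq <|
    (Frag.loop (Γ := Symb M) (.inl r') id fun b =>
      .push (.inr ⟨j, (M j).tm.k₀⟩) ((M j).inputAlphabet.symm b)).seq <|
    (machineFrag M j).seq <|
    (Frag.loop (Γ := Symb M) (.inr ⟨j, (M j).tm.k₁⟩) (M j).outputAlphabet fun b =>
      .push (.inl r') b).seq <|
    moveR M r' r

/-- A machine starts with all stacks but its input stack empty, and halts with all stacks but its
output stack empty and its initial state restored. Once the output is taken away it is therefore
ready for another call. -/
theorem runs_machineFrag {j : ι} {x y : Str} {n : ℕ} (h : Comp (M j) x y n) :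
    (machineFrag M j).Runs (hiddenInit M)
      (Function.update (regStacks M s) (.inr ⟨j, (M j).tm.k₀⟩) (x.map (M j).inputAlphabet.symm))
      (Function.update (regStacks M s) (.inr ⟨j, (M j).tm.k₁⟩) (y.map (M j).outputAlphabet.symm))
      n := by
  intro o
  refine ⟨o, ?_⟩
  have key := reach_putCfg j o (hiddenInit M) (regStacks M s) h
  have h1 : ∀ (k : (M j).tm.K) (z : List ((M j).tm.Γ k)) (f : ∀ k', List ((M j).tm.Γ k')),
      f k = z → (∀ k', k' ≠ k → f k' = []) → putStacks j (regStacks M s) f =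
        Function.update (regStacks M s) (.inr ⟨j, k⟩) z := by
    intro k z f hz hf
    funext k'
    rcases k' with r | ⟨i, k'⟩
    · rfl
    · by_cases hi : i = j
      · subst hi
        by_cases hk : k' = k
        · subst hk
          simp [hz]
        · rw [Function.update_of_ne (by simpa using hk)]
          simp [hf k' hk, regStacks]
      · rw [Function.update_of_ne (by simp [hi])]
        simp [putStacks, hi]
  unfold putCfg at key
  rw [h1 (M j).tm.k₀ (x.map (M j).inputAlphabet.symm), h1 (M j).tm.k₁
    (y.map (M j).outputAlphabet.symm)] at key
  · have h2 : Function.update (hiddenInit M) j (M j).tm.initialState = hiddenInit M :=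
      Function.update_eq_self _ _
    simp only [initList, haltList, h2] at key
    exact key
  · simp [haltList]
  · intro k' hk'
    simp [haltList, hk']
  · simp [initList]
  · intro k' hk'
    simp [initList, hk']

/-- Every transfer between stacks reverses the string. Input and output each pass through `r'`,
hence are reversed twice; the four transfers take `2 * length + 1` steps each. -/
theorem does_call {j : ι} {y : Str} {n : ℕ} (hr : r ≠ r') (h : Comp (M j) (s r) y n)
    (hr' : s r' = []) :
    Does (callR M j r r') s (Function.update s r y) (n + 4 * (s r).length + 4 * y.length + 4) := by
  have e1 := does_move (M := M) (s := s) hr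
  rw [hr', List.append_nil] at e1
  set s1 := Function.update (Function.update s r []) r' [] with hs1
  have es1 : regStacks M s1 (.inl r') = [] := by simp [s1, regStacks]
  have e2 := Frag.runs_loop_push (Γ := Symb M) (k := .inl r') (k' := .inr ⟨j, (M j).tm.k₀⟩)
    (w := hiddenInit M) (S := Function.update (regStacks M s1) (.inl r') (s r).reverse) (e := id)
    (by simp) (M j).inputAlphabet.symm (s r).reverse (by simp)
  have e3 := runs_machineFrag (s := s1) h
  have e4 := Frag.runs_loop_push (Γ := Symb M) (k := .inr ⟨j, (M j).tm.k₁⟩) (k' := .inl r')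
    (w := hiddenInit M) (S := Function.update (regStacks M s1) (.inr ⟨j, (M j).tm.k₁⟩)
      (y.map (M j).outputAlphabet.symm)) (e := (M j).outputAlphabet)
    (by simp) id (y.map (M j).outputAlphabet.symm) (by simp)
  have e5 := does_move (M := M) (s := Function.update s1 r' y.reverse) hr.symm
  have a1 : Function.update (Function.update s r []) r' (s r).reverse =
      Function.update s1 r' (s r).reverse := by simp [s1]
  rw [a1] at e1
  unfold Does at e1
  rw [regStacks_update] at e1
  have a2 : Function.update (regStacks M s1) (.inl r') [] = regStacks M s1 := by
    rw [← es1, Function.update_eq_self]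
  have a3 : Function.update (regStacks M s1) (.inr ⟨j, (M j).tm.k₁⟩) [] = regStacks M s1 :=
    Function.update_eq_self (f := regStacks M s1) _
  rw [Function.update_idem, a2] at e2
  rw [Function.update_idem, a3] at e4
  unfold Does at e5
  rw [regStacks_update] at e5
  have b2 : Function.update (regStacks M s) (.inl r) y = regStacks M (Function.update s r y) :=
    (regStacks_update s r y).symm
  have a5 : Function.update (Function.update (Function.update s1 r' y.reverse) r' []) r
      ((Function.update s1 r' y.reverse r').reverse ++ Function.update s1 r' y.reverse r) =
      Function.update s r y := by
    have : Function.update s r' [] = s := by rw [← hr', Function.update_eq_self]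
    simp [s1, hr, Function.update_comm hr, this]
  rw [a5] at e5
  simp only [id, List.map_id', List.map_map, Function.comp_def, Equiv.apply_symm_apply,
    List.reverse_reverse, List.map_reverse, Function.update_self, ne_eq, reduceCtorEq,
    not_false_eq_true, Function.update_of_ne, regStacks, List.append_nil, List.length_reverse,
    List.length_map, show s1 r' = [] from es1] at e2 e4 e5
  have e := e1.seq (e2.seq (e3.seq (e4.seq e5)))
  exact Frag.Runs.mono e (by omega)

/-- The program `F` as a machine with input register `r` and output register `r'`. -/
def toMachine (M : ι → TM2ComputableAux Bool Bool) [Fintype ι] (F : Prog M) (r r' : Fin 4) :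
    TM2ComputableAux Bool Bool where
  tm :=
    { K := StackIx M
      kFin :=
        let := fun j => (M j).tm.kFin
        inferInstance
      k₀ := .inl r
      k₁ := .inl r'
      Γ := Symb M
      Λ := F.Λ
      main := F.entry
      ΛFin := F.fin
      σ := Option Bool × HiddenState M
      initialState := (none, hiddenInit M)
      σFin :=
        let := fun j => (M j).tm.σFin
        inferInstance
      Γk₀Fin := inferInstanceAs (Fintype Bool)
      -- The halting configuration prescribed by Mathlib has the initial state, so the buffer is
      -- reset before halting.
      m := fun l => mapStmt id (.load (fun _ => (none, hiddenInit M)) .halt) (F.m l) }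
  inputAlphabet := Equiv.refl Bool
  outputAlphabet := Equiv.refl Bool

theorem comp_toMachine [Fintype ι] {x y : Str}
    (h : Does F (Function.update (fun _ => []) r x) (Function.update (fun _ => []) r' y) t) :
    Comp (toMachine M F r r') x y t := by
  obtain ⟨o', h⟩ := h none
  have key := reach_mapStmt (g := id) (q' := .load (fun _ => (none, hiddenInit M)) .halt)
    (m' := (toMachine M F r r').tm.m) (fun _ => rfl) h rfl
  have h1 : ∀ (r : Fin 4) (x : Str) (f : ∀ k, List (Symb M k)), f (.inl r) = x →
      (∀ k, k ≠ .inl r → f k = []) → f = regStacks M (Function.update (fun _ => []) r x) := by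
    intro r x f hr hf
    funext k
    by_cases hk : k = .inl r
    · subst hk
      simp [regStacks, hr]
    · rw [hf k hk]
      rcases k with r1 | p
      · have : r1 ≠ r := by simpa using hk
        simp [regStacks, this]
      · rfl
  have h2 : initList (toMachine M F r r').tm (x.map (toMachine M F r r').inputAlphabet.symm) =
      contCfg id (.load (fun _ => (none, hiddenInit M)) .halt)
        ⟨some F.entry, (none, hiddenInit M), regStacks M (Function.update (fun _ => []) r x)⟩ := by
    rw [← h1 r x (initList (toMachine M F r r').tm
      (x.map (toMachine M F r r').inputAlphabet.symm)).stk]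
    · rfl
    · simp only [initList, toMachine]
      exact (dif_pos rfl).trans (List.map_id x)
    · intro k hk
      simp [initList, toMachine, hk]
  have h3 : haltList (toMachine M F r r').tm (y.map (toMachine M F r r').outputAlphabet.symm) =
      contCfg id (.load (fun _ => (none, hiddenInit M)) .halt) (⟨none, (o', hiddenInit M),
        regStacks M (Function.update (fun _ => []) r' y)⟩ : TM2.Cfg (Symb M) F.Λ _) := by
    rw [← h1 r' y (haltList (toMachine M F r r').tm
      (y.map (toMachine M F r r').outputAlphabet.symm)).stk]
    · rfl
    · simp only [haltList, toMachine]
      exact (dif_pos rfl).trans (List.map_id y)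
    · intro k hk
      simp [haltList, toMachine, hk]
  unfold Comp
  rw [h2, h3]
  exact key

end Registers

/-! ### Basic string machines and ways to combine machines -/

section Combinators

variable {ι : Type} [DecidableEq ι] {M : ι → TM2ComputableAux Bool Bool}

@[simp]
theorem update_vec_zero (a b c d x : Str) : Function.update ![a, b, c, d] 0 x = ![x, b, c, d] := by
  funext i
  fin_cases i <;> rfl

@[simp]
theorem update_vec_one (a b c d x : Str) : Function.update ![a, b, c, d] 1 x = ![a, x, c, d] := by
  funext i
  fin_cases i <;> rfl

@[simp]
theorem update_vec_two (a b c d x : Str) : Function.update ![a, b, c, d] 2 x = ![a, b, x, d] := by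
  funext i
  fin_cases i <;> rfl

@[simp]
theorem update_vec_three (a b c d x : Str) :
    Function.update ![a, b, c, d] 3 x = ![a, b, c, x] := by
  funext i
  fin_cases i <;> rfl

theorem update_nil_zero (x : Str) : Function.update (fun _ : Fin 4 => []) 0 x = ![x, [], [], []] := by
  funext i
  fin_cases i <;> rfl

theorem update_nil_one (x : Str) : Function.update (fun _ : Fin 4 => []) 1 x = ![[], x, [], []] := by
  funext i
  fin_cases i <;> rfl

theorem update_nil_two (x : Str) : Function.update (fun _ : Fin 4 => []) 2 x = ![[], [], x, []] := by
  funext i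
  fin_cases i <;> rfl

theorem does_push_eq {s s' : Fin 4 → Str} {r : Fin 4} (b : Bool)
    (h : Function.update s r (b :: s r) = s') : Does (pushR M r b) s s' 1 :=
  h ▸ does_push b

theorem does_move_eq {s s' : Fin 4 → Str} {r r' : Fin 4} (hr : r ≠ r')
    (h : Function.update (Function.update s r []) r' ((s r).reverse ++ s r') = s') :
    Does (moveR M r r') s s' (2 * (s r).length + 1) :=
  h ▸ does_move hr

theorem does_call_eq {s s' : Fin 4 → Str} {j : ι} {r r' : Fin 4} {y : Str} {n : ℕ} (hr : r ≠ r')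
    (h : Comp (M j) (s r) y n) (hr' : s r' = []) (hs : Function.update s r y = s') :
    Does (callR M j r r') s s' (n + 4 * (s r).length + 4 * y.length + 4) :=
  hs ▸ does_call hr h hr'

/-- A loop is a left fold over the register it consumes: `st l z` is the register content when `l`
is still to be read and `z` has been accumulated. -/
theorem does_loop {X : Type} {r : Fin 4} {B : Bool → Prog M} (st : Str → X → Fin 4 → Str)
    (f : X → Bool → X) (c : ℕ) (h₀ : ∀ l z, st l z r = l)
    (h : ∀ b l z, Does (B b) (Function.update (st (b :: l) z) r l) (st l (f z b)) c) (l : Str)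
    (z : X) : Does (loopR r B) (st l z) (st [] (l.foldl f z)) ((c + 1) * l.length + 1) := by
  induction l generalizing z with
  | nil => exact (does_loop_nil (h₀ [] z)).mono (by simp)
  | cons b l ih =>
    refine (Does.loop_cons (h₀ (b :: l) z) (h b l z) (ih (f z b))).mono ?_
    rw [List.length_cons, Nat.mul_add]
    omega

/-- Clears a register. -/
theorem does_clear {r : Fin 4} {s s' : Fin 4 → Str} (h : Function.update s r [] = s') :
    Does (loopR r fun _ => (.skip : Prog M)) s s' (2 * (s r).length + 1) := by
  have := does_loop (M := M) (r := r) (B := fun _ => .skip) (fun l (_ : Unit) => Function.update s r l)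
    (fun _ _ => ()) 1 (by simp) (fun b l z => by simpa using does_skip) (s r) ()
  rw [Function.update_eq_self, h] at this
  exact this

theorem foldl_cons (l y : Str) : l.foldl (fun z b => b :: z) y = l.reverse ++ y := by
  induction l generalizing y with
  | nil => rfl
  | cons b l ih => simp [ih]

/-- Copies the register `0` to the register `1`. -/
def dupR (M : ι → TM2ComputableAux Bool Bool) : Prog M :=
  (moveR M 0 2).seq (loopR 2 fun b => (pushR M 0 b).seq (pushR M 1 b))

theorem does_dup (x : Str) :
    Does (dupR M) ![x, [], [], []] ![x, x, [], []] (5 * x.length + 2) := by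
  have h1 := does_move_eq (M := M) (s := ![x, [], [], []]) (s' := ![[], [], x.reverse, []])
    (r := 0) (r' := 2) (by decide) (by simp)
  have h2 := does_loop (M := M) (r := 2) (B := fun b => (pushR M 0 b).seq (pushR M 1 b))
    (fun l (z : Str) => ![z, z, l, []]) (fun z b => b :: z) 2 (by simp)
    (fun b l z => (does_push_eq b rfl).seq (does_push_eq b (by simp))) x.reverse []
  rw [foldl_cons] at h2
  simp only [List.reverse_reverse, List.append_nil] at h2
  exact (h1.seq h2).mono (by simp; omega)

theorem exists_id : ∃ P, ∀ x, Comp P x x 1 :=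
  ⟨toMachine (fun i : Empty => i.elim) .skip 0 0, fun _ => comp_toMachine does_skip⟩

theorem exists_const (y : Str) : ∃ P c, ∀ x, Comp P x y (c * (x.length + 1)) := by
  have h : ∀ y : Str, ∃ (F : Prog (fun i : Empty => i.elim)) (c : ℕ),
      Does F ![[], [], [], []] ![y, [], [], []] c := by
    intro y
    induction y with
    | nil => exact ⟨.skip, 1, does_skip⟩
    | cons b y ih =>
      obtain ⟨F, c, h⟩ := ih
      exact ⟨F.seq (pushR _ 0 b), c + 1, h.seq (does_push_eq b (by simp))⟩
  obtain ⟨F, c, h⟩ := h y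
  refine ⟨toMachine _ ((loopR 0 fun _ => .skip).seq F) 0 0, c + 2, fun x => comp_toMachine ?_⟩
  rw [update_nil_zero, update_nil_zero]
  refine ((does_clear (s' := ![[], [], [], []]) (by simp)).seq h).mono ?_
  simp only [Matrix.cons_val_zero]
  nlinarith

theorem exists_cons (b : Bool) : ∃ P, ∀ x, Comp P x (b :: x) 1 := by
  refine ⟨toMachine (fun i : Empty => i.elim) (pushR _ 0 b) 0 0, fun _ => comp_toMachine ?_⟩
  rw [update_nil_zero, update_nil_zero]
  exact does_push_eq b (by simp)

theorem exists_flip : ∃ P, ∀ b x, Comp P (b :: x) ((!b) :: x) 2 := by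
  refine ⟨toMachine (fun i : Empty => i.elim) (caseR 0 fun o => o.elim .skip fun b => pushR _ 0 !b)
    0 0, fun b x => comp_toMachine ?_⟩
  rw [update_nil_zero, update_nil_zero]
  exact Does.case_cons (b := b) (l := x) rfl (does_push_eq _ (by simp))

theorem exists_comp (M N : TM2ComputableAux Bool Bool) : ∃ P c, ∀ x y z t t',
    Comp M x y t → Comp N y z t' →
      Comp P x z (t + t' + c * (x.length + y.length + z.length + 1)) := by
  refine ⟨toMachine ![M, N] ((callR _ 0 0 1).seq (callR _ 1 0 1)) 0 0, 8,
    fun x y z t t' h h' => comp_toMachine ?_⟩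
  rw [update_nil_zero, update_nil_zero]
  refine ((does_call_eq (s' := ![y, [], [], []]) (y := y) (n := t) (by decide) h rfl (by simp)).seq
    (does_call_eq (y := z) (n := t') (by decide) h' rfl (by simp))).mono ?_
  simp only [Matrix.cons_val_zero]
  omega

theorem length_block (x : Str) : (block x).length = 2 * x.length + 1 := by
  induction x with
  | nil => rfl
  | cons b x ih =>
    simp only [block, List.flatMap_cons, List.length_append, List.length_cons,
      List.length_nil] at ih ⊢
    omega

/-- A stack builds the pair from right to left: the terminating `false` first, then the bits of `x`
from the last one on, each followed by its marker. -/
theorem foldl_block (x w : Str) :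
    x.reverse.foldl (fun z b => true :: b :: z) (false :: w) = pairStr x w := by
  rw [List.foldl_reverse]
  induction x with
  | nil => rfl
  | cons b x ih => simpa [pairStr, block] using ih

theorem exists_pair (M N : TM2ComputableAux Bool Bool) : ∃ P c, ∀ x y z t t',
    Comp M x y t → Comp N x z t' →
      Comp P x (pairStr y z) (t + t' + c * (x.length + y.length + z.length + 1)) := by
  refine ⟨toMachine ![M, N] ((dupR _).seq ((callR _ 0 0 2).seq ((callR _ 1 1 2).seq
    ((pushR _ 1 false).seq ((moveR _ 0 2).seq (loopR 2 fun b => (pushR _ 1 b).seq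
      (pushR _ 1 true))))))) 0 1, 20,
    fun x y z t t' h h' => comp_toMachine ?_⟩
  rw [update_nil_zero, update_nil_one]
  have h2 := does_loop (M := ![M, N]) (r := 2) (B := fun b => (pushR _ 1 b).seq (pushR _ 1 true))
    (fun l (z : Str) => ![[], z, l, []]) (fun z b => true :: b :: z) 2 (by simp)
    (fun b l z => (does_push_eq b rfl).seq (does_push_eq true (by simp))) y.reverse (false :: z)
  rw [foldl_block] at h2
  refine ((does_dup x).seq ((does_call_eq (s' := ![y, x, [], []]) (y := y) (n := t) (by decide) h
    rfl (by simp)).seq ((does_call_eq (s' := ![y, z, [], []]) (y := z) (n := t') (by decide) h'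
    rfl (by simp)).seq ((does_push_eq (s' := ![y, false :: z, [], []]) false (by simp)).seq
    ((does_move_eq (by decide) (by simp)).seq h2))))).mono ?_
  simp only [Matrix.cons_val_zero, Matrix.cons_val_one, List.length_reverse]
  omega

theorem exists_cond (C M N : TM2ComputableAux Bool Bool) : ∃ P c, ∀ x b y t t',
    Comp C x [b] t → Comp (bif b then M else N) x y t' →
      Comp P x y (t + t' + c * (x.length + y.length + 1)) := by
  refine ⟨toMachine ![C, M, N] ((dupR _).seq ((callR _ 0 1 2).seq (caseR 1 fun o =>
    o.elim .skip fun b => bif b then callR _ 1 0 2 else callR _ 2 0 2))) 0 0, 20,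
    fun x b y t t' h h' => comp_toMachine ?_⟩
  rw [update_nil_zero, update_nil_zero]
  have h3 : Does (M := ![C, M, N]) (bif b then callR _ 1 0 2 else callR _ 2 0 2) ![x, [], [], []]
      ![y, [], [], []] (t' + 4 * x.length + 4 * y.length + 4) := by
    cases b
    · exact does_call_eq (M := ![C, M, N]) (j := 2) (by decide) h' rfl (by simp)
    · exact does_call_eq (M := ![C, M, N]) (j := 1) (by decide) h' rfl (by simp)
  refine ((does_dup x).seq ((does_call_eq (M := ![C, M, N]) (j := 0) (r := 1) (r' := 2)
    (s := ![x, x, [], []]) (s' := ![x, [b], [], []]) (y := [b]) (n := t) (by decide)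
    h rfl (by simp)).seq (Does.case_cons (b := b) (l := []) rfl
    (by rw [update_vec_one]; exact h3)))).mono ?_
  simp only [Matrix.cons_val_one, Matrix.cons_val_zero, List.length_singleton]
  omega

/-- The first bit of the body's output tells whether to go on with the rest or to return it.
Register `1` controls the loop: it holds one bit exactly when another round is due. The single bound
`t` covers the time of each round and the lengths of the strings. -/
theorem exists_while (M : TM2ComputableAux Bool Bool) : ∃ P c, ∀ (z : ℕ → Str) (n : ℕ) (y : Str)
    (t : ℕ), (∀ i < n, Comp M (z i) (true :: z (i + 1)) t) → Comp M (z n) (false :: y) t →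
      (∀ i ≤ n, (z i).length ≤ t) → y.length ≤ t → Comp P (z 0) y (c * (n + 1) * (t + 1)) := by
  let B : Prog fun _ : Unit => M := (callR _ () 0 2).seq (caseR 0 fun o =>
    bif o.getD false then pushR _ 1 true else .skip)
  have hB : ∀ (z : Str) (b : Bool) (z' : Str) (t : ℕ), Comp M z (b :: z') t →
      Does B ![z, [], [], []] ![z', bif b then [true] else [], [], []]
        (t + 4 * z.length + 4 * z'.length + 10) := by
    intro z b z' t h
    refine (Does.seq (s' := ![b :: z', [], [], []]) (does_call_eq (M := fun _ : Unit => M) (j := ())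
      (y := b :: z') (n := t) (by decide) h rfl (by simp))
      (Does.case_cons (b := b) (l := z') (t := 1) rfl ?_)).mono ?_
    · rw [update_vec_zero]
      cases b
      · exact does_skip
      · exact does_push_eq true (by simp)
    · simp only [Matrix.cons_val_zero, List.length_cons]
      omega
  have key : ∀ (n : ℕ) (z : ℕ → Str) (y : Str)
      (t : ℕ), (∀ i < n, Comp M (z i) (true :: z (i + 1)) t) → Comp M (z n) (false :: y) t →
      (∀ i ≤ n, (z i).length ≤ t) → y.length ≤ t →
      Does (loopR 1 fun _ => B) ![z 0, [true], [], []] ![y, [], [], []]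
        (20 * (n + 1) * (t + 1) + 1) := by
    intro n
    induction n with
    | zero =>
      intro z y t _ h hz hy
      have := hz 0 le_rfl
      refine (Does.loop_cons (b := true) (l := []) rfl (by simpa using hB _ _ _ _ h)
        (does_loop_nil rfl)).mono ?_
      omega
    | succ n ih =>
      intro z y t hi h hz hy
      have := hz 0 (Nat.zero_le _)
      have := hz 1 (by omega)
      refine (Does.loop_cons (b := true) (l := []) rfl
        (by simpa using hB _ _ _ _ (hi 0 (by omega)))
        (ih (fun i => z (i + 1)) y t (fun i h => hi (i + 1) (by omega)) h
          (fun i h => hz (i + 1) (by omega)) hy)).mono ?_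
      nlinarith
  refine ⟨toMachine _ ((pushR _ 1 true).seq (loopR 1 fun _ => B)) 0 0, 22,
    fun z n y t h1 h2 h3 h4 => comp_toMachine ?_⟩
  rw [update_nil_zero, update_nil_zero]
  refine ((does_push_eq (s' := ![z 0, [true], [], []]) true (by simp)).seq
    (key n z y t h1 h2 h3 h4)).mono ?_
  nlinarith

/-- Splits a string into the two components of a pair. -/
def splitStr : Str → Str × Str
  | true :: b :: l => (b :: (splitStr l).1, (splitStr l).2)
  | false :: l => ([], l)
  | _ => ([], [])

@[simp]
theorem splitStr_pairStr (x w : Str) : splitStr (pairStr x w) = (x, w) := by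
  induction x with
  | nil => rfl
  | cons b x ih =>
    change splitStr (true :: b :: pairStr x w) = _
    rw [splitStr, ih]

theorem length_splitStr (x : Str) : (splitStr x).1.length + (splitStr x).2.length ≤ x.length := by
  induction x using splitStr.induct with
  | case1 b l ih =>
    simp only [splitStr, List.length_cons]
    omega
  | case2 l => simp [splitStr]
  | case3 => simp [splitStr]

/-- Splits the register `0`, putting the reverse of the first component onto the register `1`. -/
def splitR (M : ι → TM2ComputableAux Bool Bool) : Prog M :=
  (pushR M 3 true).seq <| loopR 3 fun _ => caseR 0 fun o => bif o.getD false then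
    caseR 0 fun o => o.elim .skip fun b => (pushR M 1 b).seq (pushR M 3 true) else .skip

theorem does_split (x : Str) : Does (splitR M) ![x, [], [], []]
    ![(splitStr x).2, (splitStr x).1.reverse, [], []] (6 * x.length + 6) := by
  have key : ∀ x y : Str, Does (M := M) (loopR 3 fun _ => caseR 0 fun o => bif o.getD false then
      caseR 0 fun o => o.elim .skip fun b => (pushR M 1 b).seq (pushR M 3 true) else .skip)
      ![x, y, [], [true]] ![(splitStr x).2, (splitStr x).1.reverse ++ y, [], []]
      (6 * x.length + 5) := by
    intro x
    induction x using splitStr.induct with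
    | case1 b l ih =>
      intro y
      refine (Does.loop_cons (b := true) (l := []) rfl (Does.case_cons (b := true) (l := b :: l) rfl
        (Does.case_cons (b := b) (l := l) rfl ((does_push_eq (s' := ![l, b :: y, [], []]) b
          (by simp)).seq (does_push_eq (s' := ![l, b :: y, [], [true]]) true (by simp))))) ?_).mono
          (t := 4 + (6 * l.length + 5) + 1) ?_
      · simpa [splitStr] using ih (b :: y)
      · simp
        omega
    | case2 l =>
      intro y
      refine (Does.loop_cons (b := true) (l := []) rfl (Does.case_cons (b := false) (l := l) rfl
        (s' := ![l, y, [], []]) (t := 1) ?_) (does_loop_nil rfl)).mono (by omega)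
      simpa using does_skip
    | case3 x h1 h2 =>
      intro y
      match x with
      | [] =>
        refine (Does.loop_cons (b := true) (l := []) rfl (Does.case_nil rfl
          (s' := ![[], y, [], []]) (t := 1) ?_) (does_loop_nil rfl)).mono (by omega)
        simpa using does_skip
      | [true] =>
        refine (Does.loop_cons (b := true) (l := []) rfl (Does.case_cons (b := true) (l := []) rfl
          (Does.case_nil rfl (s' := ![[], y, [], []]) (t := 1) ?_)) (does_loop_nil rfl)).mono
            (by omega)
        simpa using does_skip
      | false :: l => exact (h2 l rfl).elim
      | true :: b :: l => exact (h1 b l rfl).elim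
  have := key x []
  rw [List.append_nil] at this
  exact ((does_push_eq true (by simp)).seq this).mono (by omega)

theorem exists_fst : ∃ P c, ∀ x, Comp P x (splitStr x).1 (c * (x.length + 1)) := by
  refine ⟨toMachine (fun i : Empty => i.elim) ((splitR _).seq ((loopR 0 fun _ => .skip).seq
    (moveR _ 1 2))) 0 2, 20, fun x => comp_toMachine ?_⟩
  rw [update_nil_zero, update_nil_two]
  refine ((does_split x).seq ((does_clear (s' := ![[], (splitStr x).1.reverse, [], []])
    (by simp)).seq (does_move_eq (by decide) (by simp)))).mono ?_
  have := length_splitStr x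
  simp
  omega

theorem exists_snd : ∃ P c, ∀ x, Comp P x (splitStr x).2 (c * (x.length + 1)) := by
  refine ⟨toMachine (fun i : Empty => i.elim) ((splitR _).seq (loopR 1 fun _ => .skip)) 0 0, 20,
    fun x => comp_toMachine ?_⟩
  rw [update_nil_zero, update_nil_zero]
  refine ((does_split x).seq (does_clear (by simp))).mono ?_
  have := length_splitStr x
  simp
  omega

/-- A step of the comparison of two strings: what remains of the second one, and a record of
the differences. -/
def compareStep (z : Str × Str) (b : Bool) : Str × Str :=
  match z.1 with
  | [] => ([], true :: z.2)
  | b' :: l => (l, if b = b' then z.2 else true :: z.2)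

/-- Each mismatch, including a second string that ends too early, leaves a mark that is never
removed, and a second string that is too long leaves a remainder. -/
theorem foldl_compareStep (x y d : Str) :
    (x.foldl compareStep (y, d) = ([], [])) ↔ x = y ∧ d = [] := by
  induction x generalizing y d with
  | nil => simp [Prod.ext_iff, eq_comm]
  | cons b x ih =>
    cases y with
    | nil => simp [compareStep, ih]
    | cons b' y =>
      rw [List.foldl_cons, compareStep, ih]
      by_cases h : b = b' <;> simp [h]

theorem length_foldl_compareStep (x y d : Str) :
    (x.foldl compareStep (y, d)).1.length + (x.foldl compareStep (y, d)).2.length ≤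
      x.length + y.length + d.length := by
  induction x generalizing y d with
  | nil => simp
  | cons b x ih =>
    refine (ih _ _).trans ?_
    cases y with
    | nil =>
      simp
      omega
    | cons b' y =>
      simp only [List.length_cons]
      split_ifs
      · omega
      · simp only [List.length_cons]
        omega

theorem exists_eq : ∃ P c, ∀ x y, Comp P (pairStr x y) [decide (x = y)]
    (c * ((pairStr x y).length + 1)) := by
  let M : Empty → TM2ComputableAux Bool Bool := fun i => i.elim
  let L : Bool → Prog M := fun b => caseR 0 fun o => o.elim (pushR _ 3 true) fun b' =>
    if b = b' then .skip else pushR _ 3 true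
  refine ⟨toMachine M ((splitR _).seq ((moveR _ 1 2).seq ((loopR 2 L).seq
    ((loopR 0 fun _ => pushR _ 3 true).seq (caseR 3 fun o => o.elim (pushR _ 0 true) fun _ =>
      (loopR 3 fun _ => .skip).seq (pushR _ 0 false)))))) 0 0, 30, fun x y => comp_toMachine ?_⟩
  rw [update_nil_zero, update_nil_zero]
  have h1 := does_split (M := M) (pairStr x y)
  rw [splitStr_pairStr] at h1
  have h2 := does_move_eq (M := M) (s := ![y, x.reverse, [], []]) (s' := ![y, [], x, []])
    (r := 1) (r' := 2) (by decide) (by simp)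
  have h3 := does_loop (M := M) (r := 2) (B := L) (fun l (z : Str × Str) => ![z.1, [], l, z.2])
    compareStep 2 (by simp) (fun b l z => by
      obtain ⟨_ | ⟨b', y⟩, d⟩ := z
      · exact Does.case_nil rfl (does_push_eq true (by simp [compareStep]))
      · refine Does.case_cons (b := b') (l := y) rfl ?_
        by_cases hb : b = b'
        · simpa [hb, compareStep] using does_skip
        · simpa [hb, compareStep] using does_push_eq true (by simp)) x (y, [])
  have hd := foldl_compareStep x y []
  have hl := length_foldl_compareStep x y []
  set z := x.foldl compareStep (y, []) with hz
  have h4 := does_loop (M := M) (r := 0) (B := fun _ => pushR _ 3 true)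
    (fun l (z : Str) => ![l, [], [], z]) (fun z _ => true :: z) 1 (by simp)
    (fun b l z => does_push_eq true (by simp)) z.1 z.2
  -- The remainder is turned into further marks, so that a single test of register `3` for emptiness
  -- decides equality.
  have hd' : z.1.foldl (fun z _ => true :: z) z.2 = [] ↔ x = y := by
    rw [and_iff_left rfl] at hd
    rw [← hd, Prod.ext_iff]
    generalize z.2 = e
    induction z.1 generalizing e with
    | nil => simp
    | cons b l ih => simp
  have hl' : (z.1.foldl (fun z _ => true :: z) z.2).length = z.1.length + z.2.length := by
    generalize z.2 = e
    induction z.1 generalizing e with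
    | nil => simp
    | cons b l ih =>
      simp
      omega
  set e := z.1.foldl (fun z _ => true :: z) z.2 with he
  have h5 : Does (M := M) (caseR 3 fun o => o.elim (pushR _ 0 true) fun _ =>
      (loopR 3 fun _ => .skip).seq (pushR _ 0 false)) ![[], [], [], e]
      ![[decide (x = y)], [], [], []] (2 * e.length + 3) := by
    rcases hee : e with _ | ⟨b, e'⟩
    · refine Does.mono (t := 2) (Does.case_nil rfl (does_push_eq true ?_)) (by omega)
      simp [hd'.1 hee]
    · have : x ≠ y := fun h => by simp [hd'.2 h] at hee
      refine (Does.case_cons (b := b) (l := e') rfl ((does_clear (s' := ![[], [], [], []])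
        (by simp)).seq (does_push_eq false (by simp [this])))).mono ?_
      simp
  refine (h1.seq (h2.seq (h3.seq (h4.seq h5)))).mono ?_
  simp [pairStr, length_block] at hl ⊢
  omega

end Combinators

/-! ### Polynomial bounds -/

/-- `f` is bounded by a polynomial in `n`. -/
def PolyBdd {α : Type} (n f : α → ℕ) : Prop := ∃ k, ∀ a, f a ≤ (n a + 2) ^ k

namespace PolyBdd

variable {α : Type} {n f g : α → ℕ}

theorem self : PolyBdd n n := ⟨1, fun a => by simp⟩

theorem const (c : ℕ) : PolyBdd n fun _ => c :=
  -- The base is at least `2`, and `c < 2 ^ c`.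
  ⟨c, fun a => (Nat.lt_two_pow_self (n := c)).le.trans (Nat.pow_le_pow_left (by omega) _)⟩

theorem mono (h : PolyBdd n g) (hfg : ∀ a, f a ≤ g a) : PolyBdd n f := by
  obtain ⟨k, h⟩ := h
  exact ⟨k, fun a => (hfg a).trans (h a)⟩

theorem of_le (h : ∀ a, f a ≤ n a) : PolyBdd n f := self.mono h

theorem mul (hf : PolyBdd n f) (hg : PolyBdd n g) : PolyBdd n fun a => f a * g a := by
  obtain ⟨k, hf⟩ := hf
  obtain ⟨l, hg⟩ := hg
  exact ⟨k + l, fun a => pow_add (n a + 2) k l ▸ Nat.mul_le_mul (hf a) (hg a)⟩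

theorem add (hf : PolyBdd n f) (hg : PolyBdd n g) : PolyBdd n fun a => f a + g a := by
  obtain ⟨k, hf⟩ := hf
  obtain ⟨l, hg⟩ := hg
  -- The additional factor `n a + 2 ≥ 2` absorbs the sum of two terms.
  refine ⟨max k l + 1, fun a => ?_⟩
  have h1 : (n a + 2) ^ k ≤ (n a + 2) ^ max k l := Nat.pow_le_pow_right (by omega) (by simp)
  have h2 : (n a + 2) ^ l ≤ (n a + 2) ^ max k l := Nat.pow_le_pow_right (by omega) (by simp)
  have := hf a
  have := hg a
  rw [pow_succ]
  nlinarith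

theorem pow (hf : PolyBdd n f) (k : ℕ) : PolyBdd n fun a => f a ^ k := by
  obtain ⟨l, hf⟩ := hf
  exact ⟨l * k, fun a => pow_mul (n a + 2) l k ▸ Nat.pow_le_pow_left (hf a) k⟩

theorem trans (hf : PolyBdd n f) (hg : PolyBdd f g) : PolyBdd n g := by
  obtain ⟨k, hg⟩ := hg
  exact ((hf.add (const 2)).pow k).mono hg

end PolyBdd

/-! ### Families of strings computed in polynomial time -/

/-- A machine computes, for each `a`, the string `v a` from `u a`, in time polynomial in the length
of `u a` and the additional budget `m a`. -/
def Feasible {α : Type} (m : α → ℕ) (u v : α → Str) : Prop :=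
  ∃ M k, ∀ a, Comp M (u a) (v a) (((u a).length + m a + 2) ^ k)

namespace Feasible

variable {α β : Type} {m : α → ℕ} {u v w : α → Str}

theorem of_polyBdd {M : TM2ComputableAux Bool Bool} (t : α → ℕ)
    (ht : PolyBdd (fun a => (u a).length + m a) t) (h : ∀ a, Comp M (u a) (v a) (t a)) :
    Feasible m u v := by
  obtain ⟨k, ht⟩ := ht
  exact ⟨M, k, fun a => (h a).mono (ht a)⟩

/-- A machine cannot write more than its time permits. This keeps intermediate results polynomially
long, which makes composition possible. -/
theorem length (h : Feasible m u v) :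
    PolyBdd (fun a => (u a).length + m a) fun a => (v a).length := by
  obtain ⟨M, k, h⟩ := h
  obtain ⟨d, hd⟩ := exists_length_le M
  exact ((PolyBdd.of_le fun a => Nat.le_add_right _ _).add
    ((PolyBdd.const d).mul ⟨k, fun _ => le_rfl⟩)).mono fun a => hd _ _ _ (h a)

theorem polyBdd_length : PolyBdd (fun a => (u a).length + m a) fun a => (u a).length :=
  .of_le fun _ => Nat.le_add_right _ _

theorem polyBdd_budget : PolyBdd (fun a => (u a).length + m a) m :=
  .of_le fun _ => Nat.le_add_left _ _

/-- Only the input and output strings and the budget matter, so the index type may be replaced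
freely. Restrictions to subtypes and case distinctions are handled in this way. -/
theorem of_factor (h : Feasible m u v) {m' : β → ℕ} {u' v' : β → Str}
    (h' : ∀ b, ∃ a, u a = u' b ∧ v a = v' b ∧ m a ≤ m' b) : Feasible m' u' v' := by
  obtain ⟨M, k, h⟩ := h
  refine ⟨M, k, fun b => ?_⟩
  obtain ⟨a, h1, h2, h3⟩ := h' b
  rw [← h1, ← h2]
  exact (h a).mono (Nat.pow_le_pow_left (by omega) k)

theorem reindex (h : Feasible m u v) (i : β → α) :
    Feasible (fun b => m (i b)) (fun b => u (i b)) fun b => v (i b) :=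
  h.of_factor fun b => ⟨i b, rfl, rfl, le_rfl⟩

theorem mono (h : Feasible m u v) {m' : α → ℕ} (hm : ∀ a, m a ≤ m' a) : Feasible m' u v :=
  h.of_factor fun a => ⟨a, rfl, rfl, hm a⟩

theorem trans (h : Feasible m u v) (h' : Feasible m v w) : Feasible m u w := by
  have hv := h.length
  have hw := (hv.add polyBdd_budget).trans h'.length
  obtain ⟨M, k, h⟩ := h
  obtain ⟨N, l, h'⟩ := h'
  obtain ⟨P, c, hP⟩ := exists_comp M N
  refine of_polyBdd _ ?_ fun a => hP _ _ _ _ _ (h a) (h' a)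
  exact (PolyBdd.add ⟨k, fun _ => le_rfl⟩
    (((hv.add polyBdd_budget).add (.const 2)).pow l)).add
      ((PolyBdd.const c).mul (((polyBdd_length.add hv).add hw).add (.const 1)))

/-- Applies a feasible function on strings that needs no additional budget. -/
theorem andThen {f : β → Str} {g : β → Str} (h : Feasible m u fun a => v a) (hf : Feasible 0 f g)
    (i : α → β) (hi : ∀ a, f (i a) = v a) : Feasible m u fun a => g (i a) :=
  h.trans ((hf.reindex i).of_factor fun a => ⟨a, hi a, rfl, Nat.zero_le _⟩)

theorem id : Feasible m u u := by
  obtain ⟨P, h⟩ := exists_id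
  exact of_polyBdd _ (.const 1) fun a => h (u a)

theorem const (y : Str) : Feasible m u fun _ => y := by
  obtain ⟨P, c, h⟩ := exists_const y
  exact of_polyBdd _ ((PolyBdd.const c).mul (polyBdd_length.add (.const 1))) fun a => h (u a)

theorem pair (h : Feasible m u v) (h' : Feasible m u w) :
    Feasible m u fun a => pairStr (v a) (w a) := by
  have hv := h.length
  have hw := h'.length
  obtain ⟨M, k, h⟩ := h
  obtain ⟨N, l, h'⟩ := h'
  obtain ⟨P, c, hP⟩ := exists_pair M N
  refine of_polyBdd _ ?_ fun a => hP _ _ _ _ _ (h a) (h' a)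
  exact (PolyBdd.add ⟨k, fun _ => le_rfl⟩ ⟨l, fun _ => le_rfl⟩).add
      ((PolyBdd.const c).mul (((polyBdd_length.add hv).add hw).add (.const 1)))

theorem splitStr_fst : Feasible 0 (fun x : Str => x) fun x => (splitStr x).1 := by
  obtain ⟨P, c, h⟩ := exists_fst
  exact of_polyBdd _ ((PolyBdd.const c).mul (polyBdd_length.add (.const 1))) h

theorem splitStr_snd : Feasible 0 (fun x : Str => x) fun x => (splitStr x).2 := by
  obtain ⟨P, c, h⟩ := exists_snd
  exact of_polyBdd _ ((PolyBdd.const c).mul (polyBdd_length.add (.const 1))) h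

theorem fst (h : Feasible m u fun a => pairStr (v a) (w a)) : Feasible m u v := by
  simpa using h.andThen splitStr_fst _ fun _ => rfl

theorem snd (h : Feasible m u fun a => pairStr (v a) (w a)) : Feasible m u w := by
  simpa using h.andThen splitStr_snd _ fun _ => rfl

theorem cons (b : Bool) (h : Feasible m u v) : Feasible m u fun a => b :: v a := by
  obtain ⟨P, hP⟩ := exists_cons b
  exact h.andThen (of_polyBdd (u := fun x => x) (v := fun x => b :: x) _ (.const 1) fun x => hP x) _
    fun _ => rfl

theorem flip {b : α → Bool} (h : Feasible m u fun a => b a :: v a) :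
    Feasible m u fun a => (!b a) :: v a := by
  obtain ⟨P, hP⟩ := exists_flip
  exact h.andThen (of_polyBdd (u := fun p : Bool × Str => p.1 :: p.2) (v := fun p => (!p.1) :: p.2) _
    (.const 2) fun p => hP p.1 p.2) (fun a => (b a, v a)) fun _ => rfl

theorem eq (h : Feasible m u v) (h' : Feasible m u w) :
    Feasible m u fun a => [decide (v a = w a)] := by
  obtain ⟨P, c, hP⟩ := exists_eq
  exact (h.pair h').andThen (of_polyBdd (u := fun p : Str × Str => pairStr p.1 p.2)
    (v := fun p => [decide (p.1 = p.2)]) _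
      ((PolyBdd.const c).mul (polyBdd_length.add (.const 1))) fun p => hP p.1 p.2)
      (fun a => (v a, w a)) fun _ => rfl

/-- Each branch has to be feasible only at the indices where it is taken. This is essential for the
backdoor finder, which is specified on `A` alone. -/
theorem ite {c : α → Bool} (hc : Feasible m u fun a => [c a])
    (h₁ : Feasible (fun a : {a // c a = true} => m a) (fun a => u a) fun a => v a)
    (h₀ : Feasible (fun a : {a // c a = false} => m a) (fun a => u a) fun a => v a) :
    Feasible m u v := by
  obtain ⟨C, i, hC⟩ := hc
  obtain ⟨M, k, hM⟩ := h₁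
  obtain ⟨N, l, hN⟩ := h₀
  obtain ⟨P, d, hP⟩ := exists_cond C M N
  obtain ⟨e, he⟩ := exists_length_le M
  obtain ⟨f, hf⟩ := exists_length_le N
  have key : ∀ a, Comp (bif c a then M else N) (u a) (v a)
      (((u a).length + m a + 2) ^ k + ((u a).length + m a + 2) ^ l) := by
    intro a
    cases ha : c a
    · exact (hN ⟨a, ha⟩).mono (Nat.le_add_left _ _)
    · exact (hM ⟨a, ha⟩).mono (Nat.le_add_right _ _)
  have hkl : PolyBdd (fun a => (u a).length + m a) fun a =>
      ((u a).length + m a + 2) ^ k + ((u a).length + m a + 2) ^ l :=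
    .add ⟨k, fun _ => le_rfl⟩ ⟨l, fun _ => le_rfl⟩
  have hv : PolyBdd (fun a => (u a).length + m a) fun a => (v a).length := by
    -- No single machine is yet known to compute `v`, so its length is bounded through whichever of
    -- the two branch machines produces it.
    refine (polyBdd_length.add ((PolyBdd.const (e + f)).mul hkl)).mono fun a => ?_
    have ha := key a
    cases hc : c a
    · rw [hc] at ha
      exact (hf _ _ _ ha).trans (by gcongr; omega)
    · rw [hc] at ha
      exact (he _ _ _ ha).trans (by gcongr; omega)
  refine of_polyBdd _ ?_ fun a => hP _ _ _ _ _ (hC a) (key a)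
  exact (PolyBdd.add ⟨i, fun _ => le_rfl⟩ hkl).add
    ((PolyBdd.const d).mul ((polyBdd_length.add hv).add (.const 1)))

theorem and {c d : α → Bool} (hc : Feasible m u fun a => [c a]) (hd : Feasible m u fun a => [d a]) :
    Feasible m u fun a => [c a && d a] :=
  ite hc ((hd.reindex Subtype.val).of_factor fun a => ⟨a, rfl, by simp [a.2], le_rfl⟩)
    ((const [false]).of_factor fun a => ⟨a, rfl, by simp [a.2], le_rfl⟩)

theorem not {c : α → Bool} (hc : Feasible m u fun a => [c a]) : Feasible m u fun a => [!c a] :=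
  flip (v := fun _ => []) hc

theorem or {c d : α → Bool} (hc : Feasible m u fun a => [c a]) (hd : Feasible m u fun a => [d a]) :
    Feasible m u fun a => [c a || d a] := by
  simpa using (hc.not.and hd.not).not

/-- Adds a component to the data that the computation starts from. -/
theorem weaken {γ : Type} (h : Feasible m u v) (i : γ → α) (x : γ → Str) :
    Feasible (fun c => m (i c)) (fun c => pairStr (u (i c)) (x c)) fun c => v (i c) :=
  (fst id).trans (h.reindex i)

end Feasible

/-! ### Folds over encoded lists -/

theorem encodeStrList_cons (x : Str) (l : List Str) :
    encodeStrList (x :: l) = pairStr x (encodeStrList l) := rfl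

theorem length_pairStr (x w : Str) : (pairStr x w).length = 2 * x.length + 1 + w.length := by
  rw [pairStr, List.length_append, length_block]

theorem length_le_length_encodeStrList (l : List Str) : l.length ≤ (encodeStrList l).length := by
  induction l with
  | nil => rfl
  | cons x l ih =>
    rw [encodeStrList_cons, length_pairStr, List.length_cons]
    omega

theorem encodeStrList_append (l l' : List Str) :
    encodeStrList (l ++ l') = encodeStrList l ++ encodeStrList l' := List.flatMap_append

namespace Feasible

variable {α β ω : Type} {m : α → ℕ} {u : α → Str} {es : ω → Str} {e : β → Str}
  {l : α → List β} {s : α → ω} {step : α → ω → β → ω}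

/-- The data of a fold in progress. -/
def foldData (u : α → Str) (es : ω → Str) (e : β → Str) (p : α × ω × List β) : Str :=
  pairStr (u p.1) (pairStr (es p.2.1) (encodeStrList (p.2.2.map e)))

/-- This is the loop body required by `exists_while`. An encoded list is an iterated pair, so
splitting a pair separates head and tail, and only the empty list has an empty encoding. -/
theorem foldBody
    (hstep : Feasible (fun p : α × ω × β => m p.1)
      (fun p => pairStr (u p.1) (pairStr (es p.2.1) (e p.2.2)))
      fun p => es (step p.1 p.2.1 p.2.2)) :
    Feasible (fun p : α × ω × List β => m p.1) (foldData u es e) fun p =>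
      match p.2.2 with
      | [] => false :: es p.2.1
      | b :: l => true :: foldData u es e (p.1, step p.1 p.2.1 b, l) := by
  refine ite (c := fun p => decide (encodeStrList (p.2.2.map e) = [])) (eq id.snd.snd (const _))
    ?_ ?_
  · refine (cons false id.snd.fst).of_factor (α := α × ω × List β) (u := foldData u es e)
      (m := fun p => m p.1) fun ⟨⟨a, s, l⟩, hl⟩ => ⟨(a, s, l), rfl, ?_, le_rfl⟩
    cases l with
    | nil => rfl
    | cons b l => simp [encodeStrList_cons, pairStr, block] at hl
  · have h1 : Feasible (fun p : α × ω × β × List β => m p.1)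
        (fun p => pairStr (u p.1) (pairStr (es p.2.1) (pairStr (e p.2.2.1)
          (encodeStrList (p.2.2.2.map e)))))
        fun p => true :: foldData u es e (p.1, step p.1 p.2.1 p.2.2.1, p.2.2.2) := by
      refine cons true (pair id.fst (pair ?_ id.snd.snd.snd))
      exact (pair id.fst (pair id.snd.fst id.snd.snd.fst)).trans
        (hstep.reindex fun p : α × ω × β × List β => (p.1, p.2.1, p.2.2.1))
    refine h1.of_factor fun ⟨⟨a, s, l⟩, hl⟩ => ?_
    cases l with
    | nil => simp [encodeStrList] at hl
    | cons b l => exact ⟨(a, s, b, l), rfl, rfl, le_rfl⟩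

/-- The number of rounds is bounded by the length of the encoded list. A feasible step is not
sufficient, as the accumulator might grow by a constant factor in every round; the bound `B` on the
accumulators of all prefixes excludes this. -/
theorem foldl (hl : Feasible m u fun a => encodeStrList ((l a).map e))
    (hs : Feasible m u fun a => es (s a))
    (hstep : Feasible (fun p : α × ω × β => m p.1)
      (fun p => pairStr (u p.1) (pairStr (es p.2.1) (e p.2.2)))
      fun p => es (step p.1 p.2.1 p.2.2))
    (B : α → ℕ) (hB : PolyBdd (fun a => (u a).length + m a) B)
    (h : ∀ a l', l' <+: l a → (es (l'.foldl (step a) (s a))).length ≤ B a) :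
    Feasible m u fun a => es ((l a).foldl (step a) (s a)) := by
  have hll := hl.length
  obtain ⟨M, k, hM⟩ := foldBody hstep
  obtain ⟨P, c, hP⟩ := exists_while M
  have key : Feasible m (fun a => foldData u es e (a, s a, l a))
      fun a => es ((l a).foldl (step a) (s a)) := by
    -- `Z a` bounds the length of the loop data in every round.
    let Z : α → ℕ := fun a =>
      2 * (u a).length + 1 + (2 * B a + 1 + (encodeStrList ((l a).map e)).length)
    have hle : ∀ a, (u a).length + m a ≤ (foldData u es e (a, s a, l a)).length + m a := by
      intro a
      simp only [foldData, length_pairStr]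
      omega
    have hZ : PolyBdd (fun a => (foldData u es e (a, s a, l a)).length + m a) Z := by
      refine PolyBdd.trans (PolyBdd.of_le hle) ?_
      exact (((PolyBdd.const 2).mul polyBdd_length).add (.const 1)).add
        ((((PolyBdd.const 2).mul hB).add (.const 1)).add hll)
    refine of_polyBdd (M := P) (fun a => c * ((l a).length + 1) * ((Z a + m a + 2) ^ k + Z a + 1)) ?_
      fun a => ?_
    · refine ((PolyBdd.const c).mul (PolyBdd.add (f := fun a => (l a).length) (hZ.mono fun a => ?_)
        (.const 1))).mul ((PolyBdd.add (((hZ.add polyBdd_budget).add (.const 2)).pow k) hZ).add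
          (.const 1))
      have := length_le_length_encodeStrList ((l a).map e)
      rw [List.length_map] at this
      simp only [Z]
      omega
    · have hz : ∀ i, (foldData u es e (a, ((l a).take i).foldl (step a) (s a),
          (l a).drop i)).length ≤ Z a := by
        intro i
        have h1 := h a ((l a).take i) (List.take_prefix i (l a))
        have h2 : (encodeStrList ((l a).map e)).length =
            (encodeStrList (((l a).take i).map e)).length +
              (encodeStrList (((l a).drop i).map e)).length := by
          rw [← List.length_append, ← encodeStrList_append, ← List.map_append,
            List.take_append_drop]
        simp only [foldData, length_pairStr, Z]
        omega
      -- The summand `Z a` makes the time bound also a bound for the lengths, as `exists_while`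
      -- demands.
      have ht : ∀ i, ((foldData u es e (a, ((l a).take i).foldl (step a) (s a),
          (l a).drop i)).length + m a + 2) ^ k ≤ (Z a + m a + 2) ^ k + Z a := fun i =>
        (Nat.pow_le_pow_left (by have := hz i; omega) k).trans (Nat.le_add_right _ _)
      have h0 := hP (fun i => foldData u es e (a, ((l a).take i).foldl (step a) (s a), (l a).drop i))
        (l a).length (es ((l a).foldl (step a) (s a))) ((Z a + m a + 2) ^ k + Z a) ?_ ?_
        (fun i _ => (hz i).trans (Nat.le_add_left _ _)) ?_
      · simpa using h0
      · intro i hi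
        have := (hM (a, ((l a).take i).foldl (step a) (s a), (l a).drop i)).mono (ht i)
        rw [List.drop_eq_getElem_cons hi] at this
        rw [List.drop_eq_getElem_cons hi, List.take_succ_eq_append_getElem hi, List.foldl_append]
        exact this
      · have := (hM (a, ((l a).take (l a).length).foldl (step a) (s a),
          (l a).drop (l a).length)).mono (ht _)
        simpa using this
      · have := h a (l a) List.prefix_rfl
        simp only [Z]
        omega
  exact (pair id (pair hs hl)).trans key

theorem all {p : α → β → Bool} (hl : Feasible m u fun a => encodeStrList ((l a).map e))
    (hp : Feasible (fun q : α × β => m q.1) (fun q => pairStr (u q.1) (e q.2))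
      fun q => [p q.1 q.2]) : Feasible m u fun a => [(l a).all (p a)] := by
  have h := foldl (es := fun b : Bool => [b]) (s := fun _ => true)
    (step := fun a s b => s && p a b) hl (const _) (and id.snd.fst
      ((pair id.fst id.snd.snd).trans (hp.reindex fun q : α × Bool × β => (q.1, q.2.2))))
    (fun _ => 1) (.const 1) (by simp)
  have : ∀ a (l : List β) s, l.foldl (fun s b => s && p a b) s = (s && l.all (p a)) := by
    intro a l
    induction l with
    | nil => simp
    | cons b l ih => simp [ih, Bool.and_assoc]
  simpa [this] using h

theorem any {p : α → β → Bool} (hl : Feasible m u fun a => encodeStrList ((l a).map e))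
    (hp : Feasible (fun q : α × β => m q.1) (fun q => pairStr (u q.1) (e q.2))
      fun q => [p q.1 q.2]) : Feasible m u fun a => [(l a).any (p a)] := by
  simpa [List.any_eq_not_all_not] using (hl.all hp.not).not

end Feasible

/-! ### The encodings are injective -/

theorem encodeStrList_injective : Function.Injective encodeStrList := by
  intro l l' h
  induction l generalizing l' with
  | nil =>
    cases l' with
    | nil => rfl
    | cons y l' =>
      have := length_le_length_encodeStrList (y :: l')
      rw [← h] at this
      simp [encodeStrList] at this
  | cons x l ih =>
    cases l' with
    | nil =>
      have := length_le_length_encodeStrList (x :: l)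
      rw [h] at this
      simp [encodeStrList] at this
    | cons y l' =>
      rw [encodeStrList_cons, encodeStrList_cons] at h
      have := congrArg splitStr h
      rw [splitStr_pairStr, splitStr_pairStr, Prod.mk.injEq] at this
      rw [this.1, ih this.2]

theorem encodeStrSet_injective : Function.Injective encodeStrSet := fun s t h => by
  simpa using congrArg List.toFinset (encodeStrList_injective h)

theorem encodeNat_injective : Function.Injective encodeNat :=
  Function.LeftInverse.injective decode_encodeNat

theorem encodeLit_injective : Function.Injective encodeLit := fun l l' h => by
  rw [encodeLit, encodeLit, List.cons.injEq] at h
  exact Prod.ext (encodeNat_injective h.2) h.1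

theorem encodeClause_injective : Function.Injective encodeClause :=
  encodeStrSet_injective.comp (Finset.image_injective encodeLit_injective)

theorem encodeCNF_injective : Function.Injective encodeCNF :=
  encodeStrSet_injective.comp (Finset.image_injective encodeClause_injective)

section ListOf

variable {α : Type}

theorem exists_listOf (f : α → Str) (s : Finset α) :
    ∃ l : List α, l.map f = (s.image f).sort (· ≤ ·) ∧ ∀ x ∈ l, x ∈ s := by
  have h : ∀ L : List Str, (∀ y ∈ L, y ∈ s.image f) → ∃ l : List α, l.map f = L ∧ ∀ x ∈ l, x ∈ s := by
    intro L
    induction L with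
    | nil => exact fun _ => ⟨[], by simp⟩
    | cons y L ih =>
      intro h
      obtain ⟨l, hl, hs⟩ := ih fun z hz => h z (List.mem_cons_of_mem _ hz)
      obtain ⟨x, hx, rfl⟩ := Finset.mem_image.1 (h y List.mem_cons_self)
      exact ⟨x :: l, by simp [hl], by simpa [hx] using hs⟩
  exact h _ fun y hy => (Finset.mem_sort _).1 hy

/-- The elements of a finite set, in the lexicographic order of their encodings. -/
noncomputable def listOf (f : α → Str) (s : Finset α) : List α := (exists_listOf f s).choose

/-- The encoding of a finite set is literally that of a list, so folds can run on it as given. -/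
theorem encodeStrSet_image (f : α → Str) (s : Finset α) :
    encodeStrSet (s.image f) = encodeStrList ((listOf f s).map f) :=
  congrArg encodeStrList (exists_listOf f s).choose_spec.1.symm

theorem mem_listOf {f : α → Str} (hf : Function.Injective f) {s : Finset α} {x : α} :
    x ∈ listOf f s ↔ x ∈ s := by
  refine ⟨(exists_listOf f s).choose_spec.2 x, fun h => ?_⟩
  have : f x ∈ (listOf f s).map f := by
    rw [listOf, (exists_listOf f s).choose_spec.1, Finset.mem_sort]
    exact Finset.mem_image_of_mem f h
  obtain ⟨y, hy, hxy⟩ := List.mem_map.1 this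
  exact hf hxy ▸ hy

theorem length_listOf {f : α → Str} (hf : Function.Injective f) (s : Finset α) :
    (listOf f s).length = s.card := by
  rw [← List.length_map (f := f), listOf, (exists_listOf f s).choose_spec.1, Finset.length_sort,
    Finset.card_image_of_injective s hf]

end ListOf

/-! ### The decision procedure -/

/-- The complementary literal. -/
def neg (l : Lit) : Lit := (l.1, !l.2)

/-- The literals of a clause. -/
noncomputable abbrev litsOf (C : Clause) : List Lit := listOf encodeLit C

/-- Adds the literal `l` to `T` if the other literals of the clause `C` are made false by `T`. -/
def unitStep (C T : List Lit) (l : Lit) : List Lit :=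
  if C.all fun l' => decide (l' = l) || decide (neg l' ∈ T) then l :: T else T

/-- Adds to `T` the literals that follow from the clause `C`. -/
noncomputable def clausePass (T : List Lit) (C : Clause) : List Lit :=
  (litsOf C).foldl (unitStep (litsOf C)) T

/-- A round of unit propagation. -/
noncomputable def pass (Φ : List Clause) (T : List Lit) : List Lit := Φ.foldl clausePass T

/-- As many rounds of unit propagation as there are clauses. -/
noncomputable def propagate (Φ : List Clause) (T : List Lit) : List Lit :=
  Φ.foldl (fun T _ => pass Φ T) T

/-- The set `T` of literals is consistent and contains a literal of each clause. -/
noncomputable def accepts (Φ : List Clause) (T : List Lit) : Bool :=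
  (T.all fun l => !decide (neg l ∈ T)) && Φ.all fun C => (litsOf C).any fun l => decide (l ∈ T)

/-- Extends each of the partial assignments to the variable `v` in both ways. -/
def extend (Ls : List (List Lit)) (v : ℕ) : List (List Lit) :=
  Ls.foldl (fun acc T => ((v, true) :: T) :: ((v, false) :: T) :: acc) []

/-- All assignments to the variables of the list. -/
def assignments (S : List ℕ) : List (List Lit) := S.foldl extend [[]]

/-- Decides satisfiability with the help of a backdoor. -/
noncomputable def decides (G : CNF) (S : Finset ℕ) : Bool :=
  (assignments (listOf encodeNat S)).any fun T =>
    accepts (listOf encodeClause G) (propagate (listOf encodeClause G) T)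

/-! ### Correctness -/

theorem mem_litsOf {C : Clause} {l : Lit} : l ∈ litsOf C ↔ l ∈ C := mem_listOf encodeLit_injective

theorem subset_foldl {β γ : Type} {f : List β → γ → List β} (h : ∀ T b, T ⊆ f T b) (L : List γ)
    (T : List β) : T ⊆ L.foldl f T := by
  induction L generalizing T with
  | nil => exact List.Subset.refl _
  | cons b L ih => exact List.Subset.trans (h T b) (ih _)

/-- As the accumulator only grows, an element that the step for `b` contributes to every larger
accumulator is present at the end. -/
theorem mem_foldl {β γ : Type} {f : List β → γ → List β} (h : ∀ T b, T ⊆ f T b) {L : List γ}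
    {T : List β} {b : γ} (hb : b ∈ L) {x : β} (hx : ∀ T', T ⊆ T' → x ∈ f T' b) :
    x ∈ L.foldl f T := by
  induction L generalizing T with
  | nil => cases hb
  | cons c L ih =>
    rcases List.mem_cons.1 hb with rfl | hb
    · exact subset_foldl h L _ (hx T (List.Subset.refl _))
    · exact ih hb fun T' hT' => hx T' (List.Subset.trans (h T c) hT')

theorem forall_mem_foldl {β γ : Type} {f : List β → γ → List β} {p : β → Prop} {L : List γ}
    (h : ∀ T, ∀ b ∈ L, (∀ x ∈ T, p x) → ∀ x ∈ f T b, p x) {T : List β} (hT : ∀ x ∈ T, p x) :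
    ∀ x ∈ L.foldl f T, p x := by
  induction L generalizing T with
  | nil => exact hT
  | cons c L ih =>
    exact ih (fun T b hb => h T b (List.mem_cons_of_mem _ hb)) (h T c List.mem_cons_self hT)

theorem subset_unitStep (C T : List Lit) (l : Lit) : T ⊆ unitStep C T l := by
  unfold unitStep
  split_ifs
  · exact List.subset_cons_self _ _
  · exact List.Subset.refl _

theorem subset_clausePass (T : List Lit) (C : Clause) : T ⊆ clausePass T C :=
  subset_foldl (subset_unitStep _) _ _

theorem subset_pass (Φ : List Clause) (T : List Lit) : T ⊆ pass Φ T :=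
  subset_foldl subset_clausePass _ _

/-- Completeness of a round: when it reaches `D` and `l`, the list has only grown since `T`, so the
test in `unitStep` succeeds. -/
theorem mem_pass {Φ : List Clause} {T : List Lit} {D : Clause} {l : Lit} (hD : D ∈ Φ) (hl : l ∈ D)
    (h : ∀ l' ∈ D, l' = l ∨ neg l' ∈ T) : l ∈ pass Φ T := by
  refine mem_foldl subset_clausePass hD fun T' hT' => ?_
  refine mem_foldl (subset_unitStep _) (mem_litsOf.2 hl) fun T'' hT'' => ?_
  rw [unitStep, if_pos]
  · exact List.mem_cons_self
  · simp only [List.all_eq_true, Bool.or_eq_true, decide_eq_true_eq]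
    exact fun l' hl' => (h l' (mem_litsOf.1 hl')).imp_right fun h => hT'' (hT' h)

/-- Soundness of a round: `a` makes some literal of the clause true, and it cannot be one whose
complement is in the list. -/
theorem forall_mem_pass {Φ : List Clause} {T : List Lit} {a : ℕ → Bool}
    (ha : ∀ C ∈ Φ, ∃ l ∈ C, a l.1 = l.2) (hT : ∀ l ∈ T, a l.1 = l.2) :
    ∀ l ∈ pass Φ T, a l.1 = l.2 := by
  refine forall_mem_foldl (fun T C hC hT => forall_mem_foldl (fun T l _ hT => ?_) hT) hT
  unfold unitStep
  split_ifs with h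
  · refine List.forall_mem_cons.2 ⟨?_, hT⟩
    obtain ⟨l', hl', h'⟩ := ha C hC
    simp only [List.all_eq_true, Bool.or_eq_true, decide_eq_true_eq] at h
    rcases h l' (mem_litsOf.2 hl') with rfl | h
    · exact h'
    · have := hT _ h
      simp [neg, h'] at this
  · exact hT

theorem propagate_eq_iterate (Φ : List Clause) (T : List Lit) :
    propagate Φ T = (pass Φ)^[Φ.length] T := List.foldl_const _ _ _

/-- The clauses of `F` are those of `G` that are not made true by `T`, without literals made false
by `T`. -/
def Residual (G : CNF) (T : List Lit) (F : CNF) : Prop :=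
  (∀ C ∈ F, ∃ D ∈ G, C ⊆ D ∧ ∀ l ∈ D, l ∈ C ∨ neg l ∈ T) ∧
    ∀ D ∈ G, (∃ l ∈ D, l ∈ T) ∨ ∃ C ∈ F, C ⊆ D

/-- Both conditions in `Residual` are monotone in the list of literals. Hence the invariant survives
a simplification by `l` even if `T'` contains much more than `l`, and saturation may run ahead of
the subsolver. -/
theorem Residual.assign {G F : CNF} {T T' : List Lit} {l : Lit} (h : Residual G T F) (hT : T ⊆ T')
    (hl : l ∈ T') : Residual G T' (assign F {l.1} fun _ => l.2) := by
  constructor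
  · intro C' hC'
    simp only [SatBackdoor.assign, Finset.mem_image, Finset.mem_filter] at hC'
    obtain ⟨C, ⟨hC, hCl⟩, rfl⟩ := hC'
    obtain ⟨D, hD, hCD, hDC⟩ := h.1 C hC
    refine ⟨D, hD, (Finset.filter_subset _ _).trans hCD, fun l' hl' => ?_⟩
    rcases hDC l' hl' with h1 | h1
    · by_cases h2 : l'.1 = l.1
      · right
        have h3 := hCl l' h1 (by simpa using h2)
        have : neg l' = l := Prod.ext h2 (by
          simp only [neg]
          cases h4 : l.2 <;> cases h5 : l'.2 <;> simp_all)
        rwa [this]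
      · left
        simpa [h2] using h1
    · exact .inr (hT h1)
  · intro D hD
    rcases h.2 D hD with ⟨l', h1, h2⟩ | ⟨C, hC, hCD⟩
    · exact .inl ⟨l', h1, hT h2⟩
    · by_cases h1 : l ∈ C
      · exact .inl ⟨l, hCD h1, hl⟩
      · refine .inr ⟨_, Finset.mem_image_of_mem _ (Finset.mem_filter.2 ⟨hC, fun l' hl' h2 h3 => h1 ?_⟩),
          (Finset.filter_subset _ _).trans hCD⟩
        have : l' = l := Prod.ext (by simpa using h2) h3.symm
        exact this ▸ hl'

/-- The clause `{l}` becomes true and disappears, while no new clauses arise. So the number of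
clauses bounds the number of propagation steps. -/
theorem card_assign_lt {F : CNF} {l : Lit} (h : {l} ∈ F) :
    (assign F {l.1} fun _ => l.2).card < F.card := by
  refine Finset.card_image_le.trans_lt (Finset.card_lt_card
    (Finset.filter_ssubset.2 ⟨{l}, h, fun h' => ?_⟩))
  exact h' l (Finset.mem_singleton_self l) (Finset.mem_singleton_self _) rfl

/-- Whichever unit clause `{l}` the subsolver picks, it stems from a clause of `G` whose other
literals are falsified by `T`, so one round adds `l`. Each simplification loses a clause, hence
`F.card` rounds suffice. Once no clause is left, the invariant says that `T` meets every clause of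
`G`. -/
theorem exists_mem_iterate_pass {G : CNF} (n : ℕ) {F : CNF} {T : List Lit} {b : ℕ → Bool}
    (hF : unitPropagation F = .sat b) (h : Residual G T F) (hn : F.card ≤ n) :
    ∀ D ∈ G, ∃ l ∈ D, l ∈ (pass (listOf encodeClause G))^[n] T := by
  induction n generalizing F T b with
  | zero =>
    intro D hD
    rcases h.2 D hD with h | ⟨C, hC, -⟩
    · exact h
    · simp [Finset.card_eq_zero.1 (Nat.le_zero.1 hn)] at hC
  | succ n ih =>
    rw [unitPropagation] at hF
    split_ifs at hF with h1 h2
    -- The subsolver is already done; the remaining rounds are padding and only enlarge `T`.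
    · subst h2
      refine ih (F := ∅) (T := pass _ T) (b := fun _ => false) ?_ ⟨by simp, fun D hD => ?_⟩ (by simp)
      · rw [unitPropagation]
        simp
      · rcases h.2 D hD with ⟨l, hl, hT⟩ | ⟨C, hC, -⟩
        · exact .inl ⟨l, hl, subset_pass _ _ hT⟩
        · simp at hC
    · split at hF
      · cases hF
      · rename_i l hl
        have hlF := mem_of_leastUnit hl
        split at hF
        · rename_i a ha
          refine ih (F := SatBackdoor.assign F {l.1} fun _ => l.2) (T := pass _ T) ha ?_
            (by have := card_assign_lt hlF; omega)
          refine h.assign (subset_pass _ _) ?_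
          obtain ⟨D, hD, hlD, hDl⟩ := h.1 _ hlF
          refine mem_pass ((mem_listOf encodeClause_injective).2 hD)
            (hlD (Finset.mem_singleton_self l)) fun l' hl' => ?_
          exact (hDl l' hl').imp_left Finset.mem_singleton.1
        · cases hF
        · cases hF

theorem mem_extend {Ls : List (List Lit)} {T : List Lit} (h : T ∈ Ls) (v : ℕ) (b : Bool) :
    (v, b) :: T ∈ extend Ls v := by
  refine mem_foldl (fun T b => List.Subset.trans (List.subset_cons_self _ _)
    (List.subset_cons_self _ _)) h
    fun T' _ => ?_
  cases b <;> simp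

theorem exists_mem_assignments (S : List ℕ) (a : ℕ → Bool) :
    ∃ T ∈ assignments S, (∀ v ∈ S, (v, a v) ∈ T) ∧ ∀ l ∈ T, a l.1 = l.2 := by
  induction S using List.reverseRecOn with
  | nil => exact ⟨[], by simp [assignments]⟩
  | append_singleton S v ih =>
    obtain ⟨T, hT, h1, h2⟩ := ih
    refine ⟨(v, a v) :: T, ?_, ?_, List.forall_mem_cons.2 ⟨rfl, h2⟩⟩
    · rw [assignments, List.foldl_append]
      exact mem_extend hT v (a v)
    · intro w hw
      rcases List.mem_append.1 hw with hw | hw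
      · exact List.mem_cons_of_mem _ (h1 w hw)
      · rw [List.mem_singleton.1 hw]
        exact List.mem_cons_self

theorem accepts_iff {Φ : List Clause} {T : List Lit} : accepts Φ T = true ↔
    (∀ l ∈ T, neg l ∉ T) ∧ ∀ C ∈ Φ, ∃ l ∈ C, l ∈ T := by
  simp [accepts, mem_litsOf]

/-- Acceptance is sound however the list was obtained. The backdoor property is needed only for
completeness, at the restriction of a satisfying assignment to `S`. -/
theorem decides_iff {G : CNF} {S : Finset ℕ} (hS : IsStrongBackdoor unitPropagation G S) :
    decides G S = true ↔ G ∈ SAT := by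
  unfold decides
  rw [List.any_eq_true]
  constructor
  · rintro ⟨T, -, hT⟩
    rw [accepts_iff] at hT
    set T' := propagate (listOf encodeClause G) T
    -- Variables that `T'` leaves open become false; a negative literal in `T'` is true because
    -- consistency excludes the positive one.
    refine ⟨fun v => decide ((v, true) ∈ T'), fun C hC => ?_⟩
    obtain ⟨l, hl, hlT⟩ := hT.2 C ((mem_listOf encodeClause_injective).2 hC)
    refine ⟨l, hl, ?_⟩
    obtain ⟨v, _ | _⟩ := l
    · simpa [neg] using hT.1 _ hlT
    · simpa using hlT
  · rintro ⟨a, ha⟩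
    obtain ⟨T, hT, hTS, hTa⟩ := exists_mem_assignments (listOf encodeNat S) a
    refine ⟨T, hT, accepts_iff.2 ⟨?_, fun C hC => ?_⟩⟩
    · have h : ∀ n, ∀ l ∈ (pass (listOf encodeClause G))^[n] T, a l.1 = l.2 := by
        intro n
        induction n with
        | zero => exact hTa
        | succ n ih =>
          rw [Function.iterate_succ_apply']
          exact forall_mem_pass (fun C hC => ha C ((mem_listOf encodeClause_injective).1 hC)) ih
      rw [propagate_eq_iterate]
      intro l hl hl'
      have h1 := h _ l hl
      have h2 := h _ _ hl'
      simp [neg, h1] at h2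
    · have hsat : assign G S a ∈ SAT := by
        refine ⟨a, fun C' hC' => ?_⟩
        obtain ⟨C, hC, rfl⟩ := Finset.mem_image.1 hC'
        obtain ⟨hC, hCS⟩ := Finset.mem_filter.1 hC
        obtain ⟨l, hl, hla⟩ := ha C hC
        exact ⟨l, Finset.mem_filter.2 ⟨hl, fun h => hCS l hl h hla⟩, hla⟩
      rcases hS.2.2 a with ⟨-, b, hb, -⟩ | ⟨h, -⟩
      · rw [propagate_eq_iterate]
        refine exists_mem_iterate_pass _ hb ⟨fun C' hC' => ?_, fun D hD => ?_⟩ ?_ C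
          ((mem_listOf encodeClause_injective).1 hC)
        · obtain ⟨C, hC, rfl⟩ := Finset.mem_image.1 hC'
          obtain ⟨hC, hCS⟩ := Finset.mem_filter.1 hC
          refine ⟨C, hC, Finset.filter_subset _ _, fun l hl => ?_⟩
          by_cases hlS : l.1 ∈ S
          · right
            have h1 := hTS l.1 ((mem_listOf encodeNat_injective).2 hlS)
            have h2 := hCS l hl hlS
            have : neg l = (l.1, a l.1) := Prod.ext rfl (by
              simp only [neg]
              cases h4 : l.2 <;> cases h5 : a l.1 <;> simp_all)
            rwa [this]
          · left
            exact Finset.mem_filter.2 ⟨hl, hlS⟩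
        · by_cases h : ∃ l ∈ D, l.1 ∈ S ∧ a l.1 = l.2
          · obtain ⟨l, hl, hlS, hla⟩ := h
            refine .inl ⟨l, hl, ?_⟩
            have h1 := hTS l.1 ((mem_listOf encodeNat_injective).2 hlS)
            rwa [hla] at h1
          · push Not at h
            exact .inr ⟨_, Finset.mem_image_of_mem _ (Finset.mem_filter.2 ⟨hD, h⟩),
              Finset.filter_subset _ _⟩
        -- Restriction does not increase the number of clauses, so as many rounds as `G` has clauses
        -- are enough.
        · rw [length_listOf encodeClause_injective]
          exact Finset.card_image_le.trans (Finset.card_filter_le _ _)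
      · exact (h hsat).elim

/-! ### Feasibility of the decision procedure -/

/-- The encoding of a list of literals. -/
def encodeLits (T : List Lit) : Str := encodeStrList (T.map encodeLit)

theorem encodeLits_cons (l : Lit) (T : List Lit) :
    encodeLits (l :: T) = pairStr (encodeLit l) (encodeLits T) := rfl

theorem encodeLits_litsOf (C : Clause) : encodeLits (litsOf C) = encodeClause C :=
  (encodeStrSet_image encodeLit C).symm

theorem length_encodeStrList_le_of_prefix {l l' : List Str} (h : l' <+: l) :
    (encodeStrList l').length ≤ (encodeStrList l).length := by
  obtain ⟨l'', rfl⟩ := h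
  rw [encodeStrList_append, List.length_append]
  omega

theorem length_foldl_unitStep_le (C l T : List Lit) :
    (encodeLits (l.foldl (unitStep C) T)).length ≤ (encodeLits T).length + (encodeLits l).length := by
  induction l generalizing T with
  | nil => simp
  | cons x l ih =>
    refine (ih _).trans ?_
    rw [encodeLits_cons, length_pairStr]
    unfold unitStep
    split_ifs
    · rw [encodeLits_cons, length_pairStr]
      omega
    · omega

theorem length_clausePass_le (T : List Lit) (C : Clause) :
    (encodeLits (clausePass T C)).length ≤ (encodeLits T).length + (encodeClause C).length :=
  encodeLits_litsOf C ▸ length_foldl_unitStep_le _ _ _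

theorem length_pass_le (Φ : List Clause) (T : List Lit) : (encodeLits (pass Φ T)).length ≤
    (encodeLits T).length + (encodeStrList (Φ.map encodeClause)).length := by
  unfold pass
  induction Φ generalizing T with
  | nil => simp
  | cons C Φ ih =>
    refine (ih _).trans ?_
    have := length_clausePass_le T C
    rw [List.map_cons, encodeStrList_cons, length_pairStr]
    omega

/-- Literals may be added repeatedly, but each round adds at most the length of the encoded clauses,
whatever `T` is. The growth over the rounds is additive. -/
theorem length_foldl_pass_le (Φ Ψ : List Clause) (T : List Lit) :
    (encodeLits (Ψ.foldl (fun T _ => pass Φ T) T)).length ≤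
      (encodeLits T).length + Ψ.length * (encodeStrList (Φ.map encodeClause)).length := by
  induction Ψ generalizing T with
  | nil => simp
  | cons C Ψ ih =>
    refine (ih _).trans ?_
    have := length_pass_le Φ T
    rw [List.length_cons]
    linarith

/-- The encoding of a list of lists of literals. -/
def encodeLitsList (Ls : List (List Lit)) : Str := encodeStrList (Ls.map encodeLits)

theorem length_foldl_extend (v : ℕ) (Ls acc : List (List Lit)) :
    (encodeLitsList (Ls.foldl (fun acc T => ((v, true) :: T) :: ((v, false) :: T) :: acc)
      acc)).length = (encodeLitsList acc).length + 4 * (2 * (encodeNat v).length + 3) * Ls.length +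
        2 * (encodeLitsList Ls).length := by
  induction Ls generalizing acc with
  | nil => simp [encodeLitsList, encodeStrList]
  | cons T Ls ih =>
    rw [List.foldl_cons, ih]
    simp only [encodeLitsList, List.map_cons, encodeStrList_cons, encodeLits_cons, length_pairStr,
      encodeLit, List.length_cons]
    ring

theorem length_extend (Ls : List (List Lit)) (v : ℕ) : (extend Ls v).length = 2 * Ls.length := by
  have h : ∀ acc : List (List Lit), (Ls.foldl (fun acc T =>
      ((v, true) :: T) :: ((v, false) :: T) :: acc) acc).length = acc.length + 2 * Ls.length := by
    induction Ls with
    | nil => simp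
    | cons T Ls ih =>
      intro acc
      rw [List.foldl_cons, ih]
      simp only [List.length_cons]
      ring
  exact (h []).trans (by simp)

theorem length_assignments (S : List ℕ) : (assignments S).length = 2 ^ S.length := by
  induction S using List.reverseRecOn with
  | nil => rfl
  | append_singleton S v ih =>
    rw [assignments, List.foldl_append]
    refine (length_extend _ v).trans ?_
    rw [← assignments, ih, List.length_append, List.length_singleton, pow_succ]
    ring

/-- By `length_foldl_extend`, each variable `v` doubles the length and adds `4 * (2 * |v| + 3)` for
each old assignment. The summand `1` is the length of the encoded list `[[]]`; the factor `12` is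
generous enough for the induction. -/
theorem length_encodeLitsList_assignments_le (S : List ℕ) :
    (encodeLitsList (assignments S)).length ≤
      2 ^ S.length * (1 + 12 * (encodeStrList (S.map encodeNat)).length) := by
  induction S using List.reverseRecOn with
  | nil => simp [assignments, encodeLitsList, encodeLits, encodeStrList, block]
  | append_singleton S v ih =>
    rw [assignments, List.foldl_append]
    refine (length_foldl_extend v _ []).le.trans ?_
    rw [← assignments, length_assignments, List.map_append, encodeStrList_append,
      List.length_append, List.length_append, List.length_singleton, pow_succ]
    simp only [encodeLitsList, List.map_nil, encodeStrList, List.flatMap_nil, List.length_nil,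
      List.map_cons, List.flatMap_cons, List.append_nil, length_block] at ih ⊢
    nlinarith [Nat.zero_le (2 ^ S.length * (encodeNat v).length)]

namespace Feasible

variable {α : Type} {m : α → ℕ} {u : α → Str}

theorem cond {c : α → Bool} {v w : α → Str} (hc : Feasible m u fun a => [c a])
    (hv : Feasible m u v) (hw : Feasible m u w) :
    Feasible m u fun a => if c a = true then v a else w a :=
  ite hc ((hv.reindex Subtype.val).of_factor fun a => ⟨a, rfl, by simp [a.2], le_rfl⟩)
    ((hw.reindex Subtype.val).of_factor fun a => ⟨a, rfl, by simp [a.2], le_rfl⟩)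

variable {l : α → Lit} {C T : α → List Lit} {Φ : α → List Clause}

theorem neg (hl : Feasible m u fun a => encodeLit (l a)) :
    Feasible m u fun a => encodeLit (neg (l a)) :=
  flip hl

theorem lit_eq {l' : α → Lit} (hl : Feasible m u fun a => encodeLit (l a))
    (hl' : Feasible m u fun a => encodeLit (l' a)) : Feasible m u fun a => [decide (l a = l' a)] := by
  simpa [encodeLit_injective.eq_iff] using hl.eq hl'

theorem mem (hl : Feasible m u fun a => encodeLit (l a))
    (hT : Feasible m u fun a => encodeLits (T a)) : Feasible m u fun a => [decide (l a ∈ T a)] := by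
  have := any (l := T) (e := encodeLit) (p := fun a l' => decide (l a = l')) hT
    (lit_eq (hl.weaken Prod.fst _) id.snd)
  simpa [List.any_eq] using this

theorem unitStep (hC : Feasible m u fun a => encodeLits (C a))
    (hT : Feasible m u fun a => encodeLits (T a)) (hl : Feasible m u fun a => encodeLit (l a)) :
    Feasible m u fun a => encodeLits (unitStep (C a) (T a) (l a)) := by
  have hc := all (l := C) (e := encodeLit)
    (p := fun a l' => decide (l' = l a) || decide (SatBackdoor.neg l' ∈ T a)) hC
    (or (lit_eq id.snd (hl.weaken Prod.fst _)) (mem (neg id.snd) (hT.weaken Prod.fst _)))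
  refine (hc.cond (hl.pair hT) hT).of_factor fun a => ⟨a, rfl, ?_, le_rfl⟩
  rw [SatBackdoor.unitStep]
  split_ifs <;> rfl

theorem clausePass {D : α → Clause} (hD : Feasible m u fun a => encodeClause (D a))
    (hT : Feasible m u fun a => encodeLits (T a)) :
    Feasible m u fun a => encodeLits (clausePass (T a) (D a)) := by
  have hD' : Feasible m u fun a => encodeLits (litsOf (D a)) := by simpa [encodeLits_litsOf] using hD
  refine foldl (es := encodeLits) (l := fun a => litsOf (D a)) (e := encodeLit)
    (step := fun a => SatBackdoor.unitStep (litsOf (D a))) hD' hT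
    (unitStep (hD'.weaken Prod.fst _) id.snd.fst id.snd.snd) _ (hT.length.add hD'.length)
    fun a l' hl' => (length_foldl_unitStep_le _ _ _).trans ?_
  exact Nat.add_le_add_left (length_encodeStrList_le_of_prefix (hl'.map encodeLit)) _

theorem pass (hΦ : Feasible m u fun a => encodeStrList ((Φ a).map encodeClause))
    (hT : Feasible m u fun a => encodeLits (T a)) :
    Feasible m u fun a => encodeLits (pass (Φ a) (T a)) := by
  refine foldl (es := encodeLits) (l := Φ) (e := encodeClause)
    (step := fun a => SatBackdoor.clausePass) hΦ hT
    (clausePass id.snd.snd id.snd.fst) _ (hT.length.add hΦ.length)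
    fun a l' hl' => (length_pass_le _ _).trans ?_
  exact Nat.add_le_add_left (length_encodeStrList_le_of_prefix (hl'.map encodeClause)) _

theorem propagate (hΦ : Feasible m u fun a => encodeStrList ((Φ a).map encodeClause))
    (hT : Feasible m u fun a => encodeLits (T a)) :
    Feasible m u fun a => encodeLits (propagate (Φ a) (T a)) := by
  refine foldl (es := encodeLits) (l := Φ) (e := encodeClause)
    (step := fun a T _ => SatBackdoor.pass (Φ a) T) hΦ hT
    (pass (hΦ.weaken Prod.fst _) id.snd.fst) _ (hT.length.add (hΦ.length.mul hΦ.length))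
    fun a l' hl' => (length_foldl_pass_le _ _ _).trans ?_
  have := length_le_length_encodeStrList (l'.map encodeClause)
  rw [List.length_map] at this
  exact Nat.add_le_add_left (Nat.mul_le_mul_right _
    (this.trans (length_encodeStrList_le_of_prefix (hl'.map encodeClause)))) _

theorem accepts (hΦ : Feasible m u fun a => encodeStrList ((Φ a).map encodeClause))
    (hT : Feasible m u fun a => encodeLits (T a)) :
    Feasible m u fun a => [accepts (Φ a) (T a)] := by
  have h₁ : Feasible m u fun a => [(T a).all fun l => !decide (SatBackdoor.neg l ∈ T a)] := by
    have hT' := hT.weaken (Prod.fst : α × Lit → α) fun q => encodeLit q.2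
    have hl : Feasible (fun q : α × Lit => m q.1) (fun q => pairStr (u q.1) (encodeLit q.2))
      fun q => encodeLit q.2 := id.snd
    exact all (l := T) (e := encodeLit) hT (mem (neg hl) hT').not
  have h₂ : Feasible m u fun a => [(Φ a).all fun C => (litsOf C).any fun l => decide (l ∈ T a)] := by
    refine all (l := Φ) (e := encodeClause) hΦ ?_
    have hC : Feasible (fun q : α × Clause => m q.1) (fun q => pairStr (u q.1) (encodeClause q.2))
        fun q => encodeStrList ((litsOf q.2).map encodeLit) := by
      simp only [← encodeStrSet_image]
      exact id.snd
    have hT' := (hT.weaken (Prod.fst : α × Clause → α) fun q => encodeClause q.2).weaken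
      (Prod.fst : (α × Clause) × Lit → α × Clause) fun q => encodeLit q.2
    have hl : Feasible (fun q : (α × Clause) × Lit => m q.1.1)
      (fun q => pairStr (pairStr (u q.1.1) (encodeClause q.1.2)) (encodeLit q.2))
      fun q => encodeLit q.2 := id.snd
    have hm := mem hl hT'
    have := any (l := fun q : α × Clause => litsOf q.2) (p := fun q l => decide (l ∈ T q.1)) hC hm
    exact this
  simp only [SatBackdoor.accepts]
  exact and h₁ h₂

theorem extend {Ls : α → List (List Lit)} {v : α → ℕ}
    (hL : Feasible m u fun a => encodeLitsList (Ls a))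
    (hv : Feasible m u fun a => encodeNat (v a)) :
    Feasible m u fun a => encodeLitsList (extend (Ls a) (v a)) := by
  have hv' := hv.weaken (Prod.fst : α × List (List Lit) × List Lit → α)
    fun p => pairStr (encodeLitsList p.2.1) (encodeLits p.2.2)
  have hstep : Feasible (fun p : α × List (List Lit) × List Lit => m p.1)
      (fun p => pairStr (u p.1) (pairStr (encodeLitsList p.2.1) (encodeLits p.2.2)))
      fun p => encodeLitsList (((v p.1, true) :: p.2.2) :: ((v p.1, false) :: p.2.2) :: p.2.1) := by
    have h : ∀ b, Feasible (fun p : α × List (List Lit) × List Lit => m p.1)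
        (fun p => pairStr (u p.1) (pairStr (encodeLitsList p.2.1) (encodeLits p.2.2)))
        fun p => encodeLits ((v p.1, b) :: p.2.2) := fun b => pair (hv'.cons b) id.snd.snd
    exact pair (h true) (pair (h false) id.snd.fst)
  refine foldl (es := encodeLitsList) (l := Ls) (e := encodeLits) (s := fun _ => [])
    (step := fun a acc T => ((v a, true) :: T) :: ((v a, false) :: T) :: acc) hL (const [])
    hstep
    (fun a => 4 * (2 * (encodeNat (v a)).length + 3) * (encodeLitsList (Ls a)).length +
      2 * (encodeLitsList (Ls a)).length) ?_ fun a l' hl' => ?_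
  · exact ((((PolyBdd.const 4).mul (((PolyBdd.const 2).mul hv.length).add (.const 3))).mul
      hL.length).add ((PolyBdd.const 2).mul hL.length))
  · have h1 : (encodeLitsList l').length ≤ (encodeLitsList (Ls a)).length :=
      length_encodeStrList_le_of_prefix (hl'.map encodeLits)
    have h2 : l'.length ≤ (encodeLitsList l').length := by
      simpa [encodeLitsList] using length_le_length_encodeStrList (l'.map encodeLits)
    rw [length_foldl_extend]
    have h3 : (encodeLitsList []).length = 0 := rfl
    rw [h3, Nat.zero_add]
    gcongr
    exact h2.trans h1

/-- The list of all assignments is exponentially long in `|S|`; the budget is what keeps this fold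
feasible. -/
theorem assignments {S : α → List ℕ} (hS : Feasible m u fun a => encodeStrList ((S a).map encodeNat))
    (hm : ∀ a, 2 ^ (S a).length ≤ m a) :
    Feasible m u fun a => encodeLitsList (assignments (S a)) := by
  refine foldl (es := encodeLitsList) (l := S) (e := encodeNat) (s := fun _ => [[]])
    (step := fun a => SatBackdoor.extend) hS (const _) (extend id.snd.fst id.snd.snd)
    (fun a => m a * (1 + 12 * (encodeStrList ((S a).map encodeNat)).length))
    (polyBdd_budget.mul ((PolyBdd.const 1).add ((PolyBdd.const 12).mul hS.length)))
    fun a l' hl' => (length_encodeLitsList_assignments_le l').trans ?_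
  have h1 := length_encodeStrList_le_of_prefix (hl'.map encodeNat)
  have h2 : 2 ^ l'.length ≤ m a :=
    (Nat.pow_le_pow_right (by omega) hl'.length_le).trans (hm a)
  gcongr

theorem decides {G : α → CNF} {S : α → Finset ℕ} (hG : Feasible m u fun a => encodeCNF (G a))
    (hS : Feasible m u fun a => encodeVars (S a)) (hm : ∀ a, 2 ^ (S a).card ≤ m a) :
    Feasible m u fun a => [decides (G a) (S a)] := by
  simp only [encodeCNF, encodeVars, encodeStrSet_image] at hG hS
  exact any (e := encodeLits) (p := fun a T => SatBackdoor.accepts (listOf encodeClause (G a))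
    (SatBackdoor.propagate (listOf encodeClause (G a)) T))
    (assignments hS fun a => by simpa [length_listOf encodeNat_injective] using hm a)
    (accepts (hG.weaken Prod.fst _) (propagate (hG.weaken Prod.fst _) id.snd))

end Feasible

open Filter

/-! ### Complexity classes and feasibility -/

theorem polyBdd_eval {α : Type} (n : α → ℕ) (p : Polynomial ℕ) :
    PolyBdd n fun a => p.eval (n a) := by
  induction p using Polynomial.induction_on' with
  | add p q hp hq => simpa using hp.add hq
  | monomial k c => simpa using (PolyBdd.const c).mul (PolyBdd.self.pow k)

theorem PolyTime.feasible {α β : Type} {ea : α → Str} {eb : β → Str} {f : α → β}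
    (h : PolyTime ea eb f) : Feasible 0 ea fun a => eb (f a) := by
  obtain ⟨h⟩ := h
  exact .of_polyBdd (M := h.toTM2ComputableAux) (fun a => h.time.eval (ea a).length)
    ((polyBdd_eval _ _).mono fun a => le_rfl) fun a => comp_iff.2 ⟨h.outputsFun a⟩

theorem Feasible.polyTime {α β : Type} {ea : α → Str} {eb : β → Str} {f : α → β}
    (h : Feasible 0 ea fun a => eb (f a)) : PolyTime ea eb f := by
  obtain ⟨M, k, h⟩ := h
  refine ⟨⟨M, (Polynomial.X + 2) ^ k, fun a => (comp_iff.1 ((h a).mono ?_)).some⟩⟩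
  simp

theorem Feasible.mem_DTIME {L : Set Str} {f : Str → Bool} (hf : ∀ x, f x = true ↔ x ∈ L)
    {m : ℕ → ℕ} (h : Feasible (fun x : Str => m x.length) (fun x => x) fun x => [f x])
    {W : ℕ → ℝ} (hW : ∀ k : ℕ, ∀ᶠ n : ℕ in atTop, ((n + m n + 2 : ℕ) : ℝ) ^ k ≤ 2 ^ W n) :
    L ∈ DTIME fun n => 2 ^ W n := by
  obtain ⟨M, k, h⟩ := h
  obtain ⟨N, hN⟩ := eventually_atTop.1 (hW k)
  -- The finitely many `n < N` where the estimate may fail are covered by the constant.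
  refine ⟨f, hf, ⟨M, fun n => (n + m n + 2) ^ k, fun x => (comp_iff.1 (h x)).some⟩,
    1 + ∑ i ∈ Finset.range N, ((i + m i + 2 : ℕ) : ℝ) ^ k, fun n => ?_⟩
  have hs : 0 ≤ ∑ i ∈ Finset.range N, ((i + m i + 2 : ℕ) : ℝ) ^ k :=
    Finset.sum_nonneg fun i _ => by positivity
  have hp : (0 : ℝ) < 2 ^ W n := by positivity
  have hsp := mul_nonneg hs hp.le
  rw [Nat.cast_pow]
  rcases lt_or_ge n N with hn | hn
  · have := Finset.single_le_sum (f := fun i : ℕ => ((i + m i + 2 : ℕ) : ℝ) ^ k)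
      (fun i _ => by positivity) (Finset.mem_range.2 hn)
    nlinarith
  · have := hN n hn
    nlinarith

theorem classP_subset_classNP : ClassP ⊆ ClassNP := by
  rintro L ⟨f, hf, h⟩
  -- The verifier ignores the witness, and the bound `0` admits only the empty one.
  refine ⟨{z | (splitStr z).1 ∈ L}, ⟨fun z => f (splitStr z).1, fun z => hf _, ?_⟩, 0, fun x => ?_⟩
  · exact Feasible.polyTime (Feasible.splitStr_fst.trans (h.feasible.reindex fun z => (splitStr z).1))
  · constructor
    · exact fun hx => ⟨[], by simp, by simpa using hx⟩
    · rintro ⟨w, -, hw⟩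
      simpa using hw

/-! ### Deciding NP with the help of backdoors -/

/-- Every occurrence of a literal takes up at least one symbol of the encoding. -/
theorem card_vars_le (F : CNF) : (vars F).card ≤ (encodeCNF F).length := by
  have h : ∀ l : List Clause, (vars l.toFinset).card ≤ (encodeStrList (l.map encodeClause)).length := by
    intro l
    induction l with
    | nil => simp [vars]
    | cons C l ih =>
      have h1 : vars (C :: l).toFinset = C.image Prod.fst ∪ vars l.toFinset := by
        simp [vars, Finset.biUnion_insert]
      have h2 : C.card ≤ (encodeClause C).length := by
        rw [← length_listOf encodeLit_injective C, ← encodeLits_litsOf, encodeLits]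
        simpa using length_le_length_encodeStrList ((litsOf C).map encodeLit)
      have h3 := Finset.card_union_le (C.image Prod.fst) (vars l.toFinset)
      have h4 := Finset.card_image_le (f := Prod.fst) (s := C)
      rw [h1, List.map_cons, encodeStrList_cons, length_pairStr]
      omega
  have h1 : (listOf encodeClause F).toFinset = F := by
    ext C
    rw [List.mem_toFinset, mem_listOf encodeClause_injective]
  have := h (listOf encodeClause F)
  rwa [h1, ← encodeStrSet_image] at this

theorem encodeCNF_mem_lang {A : Set CNF} {G : CNF} : encodeCNF G ∈ lang A ↔ G ∈ A :=
  encodeCNF_injective.mem_set_image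

/-- Here `(n + 2) ^ k` bounds the length of the reduced instance, hence its number of variables. The
condition on `m` says that the budget pays for all assignments to a backdoor of any size that `b`
permits there. -/
theorem exists_feasible_decision {A : Set CNF} {b : ℕ → ℝ} {L : Set Str} (hA : lang A ∈ ClassP)
    (hNP : NPComplete (lang (A ∩ SAT))) (hF : FoundInPolyTime A (IsSmallBackdoor b))
    (hL : L ∈ ClassNP) : ∃ f : Str → Bool, (∀ x, f x = true ↔ x ∈ L) ∧ ∃ k, ∀ m : ℕ → ℕ,
      (∀ n v c : ℕ, v ≤ (n + 2) ^ k → (c : ℝ) ≤ b v → 2 ^ c ≤ m n) →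
        Feasible (fun x : Str => m x.length) (fun x => x) fun x => [f x] := by
  classical
  obtain ⟨g, hg, hgL⟩ := hNP.2 L hL
  obtain ⟨d, hd, hdA⟩ := hA
  obtain ⟨φ, hφ, hφA⟩ := hF
  have hg := hg.feasible
  have hdg := hg.trans (hdA.feasible.reindex g)
  obtain ⟨k, hk⟩ := hg.length
  refine ⟨fun x => decide (x ∈ L), by simp, k, fun m hm => ?_⟩
  -- Membership in `A` is tested first, since the backdoor finder promises nothing outside `A`.
  refine Feasible.ite (c := fun x => d (g x)) (hdg.mono fun _ => Nat.zero_le _) ?_ ?_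
  · have hx : ∀ x : {x // d (g x) = true}, ∃ G : A, encodeCNF G = g x := by
      rintro ⟨x, hx⟩
      obtain ⟨G, hG, hGx⟩ := (hd _).1 hx
      exact ⟨⟨G, hG⟩, hGx⟩
    choose G hG using hx
    have h1 : Feasible (fun x : {x // d (g x) = true} => m x.1.length) (fun x => x.1)
        fun x => encodeCNF (G x) := by
      simp only [hG]
      exact (hg.reindex Subtype.val).mono fun _ => Nat.zero_le _
    have h2 : Feasible (fun x : {x // d (g x) = true} => m x.1.length) (fun x => x.1)
        fun x => encodeVars (φ (G x)) :=
      h1.trans ((hφA.feasible.reindex G).mono fun _ => Nat.zero_le _)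
    refine (h1.decides h2 fun x => hm _ (vars (G x).1).card _ ?_ (hφ (G x)).2).of_factor
      fun x => ⟨x, rfl, ?_, le_rfl⟩
    · refine (card_vars_le _).trans ?_
      rw [hG]
      exact (hk x.1).trans (by simp)
    · rw [List.cons.injEq, and_iff_left rfl, Bool.eq_iff_iff, decides_iff (hφ (G x)).1,
        decide_eq_true_iff, hgL, ← hG, encodeCNF_mem_lang]
      exact ⟨fun h => ⟨(G x).2, h⟩, fun h => h.2⟩
  · refine (Feasible.const [false]).of_factor fun x => ⟨x, rfl, ?_, le_rfl⟩
    have : ¬ x.1 ∈ L := by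
      rw [hgL]
      rintro ⟨G, hG, hGx⟩
      have := (hd (g x.1)).2 ⟨G, hG.1, hGx⟩
      rw [x.2] at this
      cases this
    simp [this]

/-! ### Growth of the running times -/

/-- The bound `b` need not be monotone, and long inputs may be reduced to formulas with few
variables. So an estimate for every `v` is needed; the constant collects the finitely many
exceptions. -/
theorem exists_forall_le_const_add {b B : ℕ → ℝ} (h : ∀ᶠ v in atTop, b v ≤ B v)
    (hB : ∀ v, 0 ≤ B v) : ∃ c : ℝ, 0 ≤ c ∧ ∀ v, b v ≤ c + B v := by
  obtain ⟨N, hN⟩ := eventually_atTop.1 h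
  have hs : 0 ≤ ∑ i ∈ Finset.range N, |b i| := Finset.sum_nonneg fun i _ => abs_nonneg _
  refine ⟨_, hs, fun v => ?_⟩
  rcases lt_or_ge v N with hv | hv
  · have h1 := Finset.single_le_sum (f := fun i => |b i|) (fun i _ => abs_nonneg _)
      (Finset.mem_range.2 hv)
    have h2 := le_abs_self (b v)
    have h3 := hB v
    linarith
  · have := hN v hv
    linarith

/-- Both `n + 2` and `2 ^ ⌊B⌋₊` are at most `2 ^ (logb 2 (n + 2) + B)`; the `+ 1` in the exponent
pays for adding them. -/
theorem time_le_two_rpow {n k : ℕ} {B : ℝ} (hB : 0 ≤ B) :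
    ((n + 2 ^ ⌊B⌋₊ + 2 : ℕ) : ℝ) ^ k ≤ 2 ^ (k * (Real.logb 2 (n + 2) + B + 1)) := by
  have hn : (0 : ℝ) < n + 2 := by positivity
  have h0 : 0 ≤ Real.logb 2 ((n : ℝ) + 2) := Real.logb_nonneg (by norm_num) (by linarith [n.cast_nonneg (α := ℝ)])
  have h1 : ((n + 2 ^ ⌊B⌋₊ + 2 : ℕ) : ℝ) ≤ 2 ^ (Real.logb 2 (n + 2) + B + 1) := by
    have e1 : (2 : ℝ) ^ ⌊B⌋₊ ≤ 2 ^ (Real.logb 2 (n + 2) + B) := by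
      rw [← Real.rpow_natCast]
      exact Real.rpow_le_rpow_of_exponent_le (by norm_num) (by linarith [Nat.floor_le hB])
    have e2 : (n : ℝ) + 2 ≤ 2 ^ (Real.logb 2 (n + 2) + B) := by
      calc (n : ℝ) + 2 = 2 ^ Real.logb 2 (n + 2) := by
            rw [Real.rpow_logb (by norm_num) (by norm_num) hn]
        _ ≤ _ := Real.rpow_le_rpow_of_exponent_le (by norm_num) (by linarith)
    rw [Real.rpow_add_one (by norm_num)]
    push_cast
    linarith
  calc _ ≤ ((2 : ℝ) ^ (Real.logb 2 (n + 2) + B + 1)) ^ k := by gcongr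
    _ = _ := by rw [← Real.rpow_natCast, ← Real.rpow_mul (by norm_num), mul_comm]

/-- The degree `l` of the final running time is known only after `B` has been fixed, so the growth
condition is required for every `l`. -/
theorem mem_DTIME_of_bound {A : Set CNF} {b : ℕ → ℝ} {L : Set Str} (hA : lang A ∈ ClassP)
    (hNP : NPComplete (lang (A ∩ SAT))) (hF : FoundInPolyTime A (IsSmallBackdoor b))
    (hL : L ∈ ClassNP) {W : ℕ → ℝ}
    (h : ∀ k : ℕ, ∃ B : ℕ → ℝ, (∀ n, 0 ≤ B n) ∧ (∀ n v, v ≤ (n + 2) ^ k → b v ≤ B n) ∧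
      ∀ l : ℕ, ∀ᶠ n : ℕ in atTop, l * (Real.logb 2 (n + 2) + B n + 1) ≤ W n) :
    L ∈ DTIME fun n => 2 ^ W n := by
  obtain ⟨f, hf, k, hk⟩ := exists_feasible_decision hA hNP hF hL
  obtain ⟨B, hB0, hB, hW⟩ := h k
  refine Feasible.mem_DTIME hf (m := fun n => 2 ^ ⌊B n⌋₊)
    (hk (fun n => 2 ^ ⌊B n⌋₊) fun n v c hv hc => ?_) fun l => ?_
  · exact Nat.pow_le_pow_right (by norm_num) (Nat.le_floor (hc.trans (hB n v hv)))
  · filter_upwards [hW l] with n hn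
    exact (time_le_two_rpow (hB0 n)).trans (Real.rpow_le_rpow_of_exponent_le (by norm_num) hn)

/-- All terms are at most a constant times `logb 2 (n + 2) ^ (e + 1)`, and `logb 2 (n + 2) ≤ 2 *
logb 2 n`. One more factor `logb 2 n` absorbs the constants. -/
theorem eventually_polylog_le (c D : ℝ) (hc : 0 ≤ c) (hD : 0 ≤ D) (e l : ℕ) :
    ∀ᶠ n : ℕ in atTop, l * (Real.logb 2 (n + 2) + (c + D * Real.logb 2 (n + 2) ^ e) + 1) ≤
      Real.logb 2 n ^ (e + 2) := by
  have ht : Tendsto (fun n : ℕ => Real.logb 2 (n : ℝ)) atTop atTop :=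
    (Real.tendsto_logb_atTop (by norm_num)).comp tendsto_natCast_atTop_atTop
  filter_upwards [ht.eventually_ge_atTop 1,
    ht.eventually_ge_atTop (l * (1 + c + D + 1) * 2 ^ (e + 1)), eventually_ge_atTop 2] with n h1 h2 hn
  have hn' : (2 : ℝ) ≤ n := by exact_mod_cast hn
  set y := Real.logb 2 (n : ℝ) with hy
  have h3 : Real.logb 2 ((n : ℝ) + 2) ≤ 2 * y := by
    have : Real.logb 2 ((n : ℝ) + 2) ≤ Real.logb 2 (n * 2) :=
      Real.logb_le_logb_of_le (by norm_num) (by positivity) (by linarith)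
    rw [Real.logb_mul (by positivity) (by norm_num), Real.logb_self_eq_one (by norm_num)] at this
    linarith
  have h4 : 1 ≤ Real.logb 2 ((n : ℝ) + 2) :=
    h1.trans (Real.logb_le_logb_of_le (by norm_num) (by positivity) (by linarith))
  set z := Real.logb 2 ((n : ℝ) + 2)
  have h5 : (1 : ℝ) ≤ z ^ (e + 1) := one_le_pow₀ h4
  have h6 : z ≤ z ^ (e + 1) := le_self_pow₀ h4 (by omega)
  have h7 : z ^ e ≤ z ^ (e + 1) := pow_le_pow_right₀ h4 (by omega)
  calc l * (z + (c + D * z ^ e) + 1)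
      ≤ l * (z ^ (e + 1) + (c * z ^ (e + 1) + D * z ^ (e + 1)) + z ^ (e + 1)) := by
        gcongr
        nlinarith
    _ = l * (1 + c + D + 1) * z ^ (e + 1) := by ring
    _ ≤ l * (1 + c + D + 1) * (2 * y) ^ (e + 1) := by gcongr
    _ = l * (1 + c + D + 1) * 2 ^ (e + 1) * y ^ (e + 1) := by ring
    _ ≤ y * y ^ (e + 1) := by gcongr
    _ = y ^ (e + 2) := by ring

/-- The logarithm and the constants are `O((n + 2) ^ (ε / 2))`; the other half of the exponent
absorbs the implied constant. -/
theorem eventually_subpoly_le (c D ε : ℝ) (hc : 0 ≤ c) (hD : 0 ≤ D) (hε : 0 < ε) (l : ℕ) :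
    ∀ᶠ n : ℕ in atTop, l * (Real.logb 2 (n + 2) + (c + D * ((n : ℝ) + 2) ^ (ε / 2)) + 1) ≤
      (n : ℝ) ^ ε := by
  have hlog : 0 < Real.log 2 := Real.log_pos (by norm_num)
  set K : ℝ := l * (1 / (ε / 2) / Real.log 2 + c + D + 1) with hK
  have hK0 : 0 ≤ K := by positivity
  have ht : Tendsto (fun n : ℕ => (n : ℝ) ^ (ε / 2)) atTop atTop :=
    (tendsto_rpow_atTop (by positivity)).comp tendsto_natCast_atTop_atTop
  filter_upwards [ht.eventually_ge_atTop (K * 2 ^ (ε / 2)), eventually_ge_atTop 2] with n h1 hn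
  have hn' : (2 : ℝ) ≤ n := by exact_mod_cast hn
  set x : ℝ := (n : ℝ) + 2 with hx
  have hx0 : 0 ≤ x := by positivity
  have h2 : (1 : ℝ) ≤ x ^ (ε / 2) := Real.one_le_rpow (by linarith) (by positivity)
  have h3 : Real.logb 2 x ≤ 1 / (ε / 2) / Real.log 2 * x ^ (ε / 2) := by
    have := Real.log_le_rpow_div hx0 (show 0 < ε / 2 by positivity)
    rw [Real.logb, div_le_iff₀ hlog]
    calc Real.log x ≤ x ^ (ε / 2) / (ε / 2) := this
      _ = _ := by field_simp
  calc l * (Real.logb 2 x + (c + D * x ^ (ε / 2)) + 1)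
      ≤ l * (1 / (ε / 2) / Real.log 2 * x ^ (ε / 2) + (c * x ^ (ε / 2) + D * x ^ (ε / 2)) +
          x ^ (ε / 2)) := by
        gcongr
        nlinarith
    _ = K * x ^ (ε / 2) := by rw [hK]; ring
    _ ≤ K * (n * 2) ^ (ε / 2) := by
        gcongr
        linarith
    _ = K * 2 ^ (ε / 2) * n ^ (ε / 2) := by
        rw [Real.mul_rpow (by positivity) (by norm_num)]
        ring
    _ ≤ n ^ (ε / 2) * n ^ (ε / 2) := by gcongr
    _ = n ^ ε := by rw [← Real.rpow_add (by positivity), add_halves]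

end SatBackdoor

/-! ### The three cases -/

open SatBackdoor
theorem mainTheorem2 :
    -- constant case
    ((∃ (k : ℕ) (A : Set CNF), 1 ≤ k ∧
        (lang A ∈ ClassP ∧ NPComplete (lang (A ∩ SAT))) ∧
        (∀ G ∈ A, ∃ S, IsSmallBackdoor (fun _ => (k : ℝ)) G S) ∧
        FoundInPolyTime A (IsSmallBackdoor fun _ => (k : ℝ))) →
      ClassP = ClassNP) ∧
    -- polylogarithmic case
    ((∃ (s : ℕ → ℝ) (A : Set CNF),
        (∃ c : ℕ, ∀ᶠ n : ℕ in Filter.atTop, s n ≤ (Real.logb 2 n) ^ c) ∧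
        (lang A ∈ ClassP ∧ NPComplete (lang (A ∩ SAT))) ∧
        (∀ G ∈ A, ∃ S, IsSmallBackdoor s G S) ∧
        FoundInPolyTime A (IsSmallBackdoor s)) →
      ClassNP ⊆ ⋃ (c : ℕ) (_ : 0 < c), DTIME fun n => (2 : ℝ) ^ ((Real.logb 2 n) ^ c)) ∧
    -- subpolynomial case
    ((∃ (r : Str → ℕ) (A : Set CNF),
        PolyTime id Computability.encodeNat r ∧
        (∀ k : ℕ, 1 ≤ k →
          (fun n : ℕ => (r (List.replicate n false) : ℝ)) =O[Filter.atTop]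
            fun n : ℕ => (n : ℝ) ^ (1 / (k : ℝ))) ∧
        (lang A ∈ ClassP ∧ NPComplete (lang (A ∩ SAT))) ∧
        (∀ G ∈ A, ∃ S,
          IsSmallBackdoor (fun n => (r (List.replicate n false) : ℝ)) G S) ∧
        FoundInPolyTime A
          (IsSmallBackdoor fun n => (r (List.replicate n false) : ℝ))) →
      ClassNP ⊆ ⋂ (ε : ℝ) (_ : 0 < ε), DTIME fun n => (2 : ℝ) ^ ((n : ℝ) ^ ε)) := by
  refine ⟨?_, ?_, ?_⟩
  · rintro ⟨k, A, -, ⟨hA, hNP⟩, -, hF⟩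
    refine classP_subset_classNP.antisymm fun L hL => ?_
    obtain ⟨f, hf, _, h⟩ := exists_feasible_decision hA hNP hF hL
    -- The number of assignments is at most the constant `2 ^ k`, so the budget disappears into the
    -- polynomial.
    have h := h (fun _ => 2 ^ k) fun n v c _ hc =>
      Nat.pow_le_pow_right (by norm_num) (by exact_mod_cast hc)
    obtain ⟨M, l, h⟩ := h
    exact ⟨f, hf, Feasible.polyTime (.of_polyBdd _
      (((Feasible.polyBdd_length.add (.const (2 ^ k))).add (.const 2)).pow l) h)⟩
  · rintro ⟨s, A, ⟨c, hs⟩, ⟨hA, hNP⟩, -, hF⟩ L hL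
    have hlog : ∀ v : ℕ, 0 ≤ Real.logb 2 (v : ℝ) := fun v => by
      -- A formula without variables gives `v = 0`, where `Real.logb` has the default value `0`.
      rcases Nat.eq_zero_or_pos v with rfl | hv
      · simp
      · exact Real.logb_nonneg (by norm_num) (by exact_mod_cast hv)
    obtain ⟨d, hd, hsd⟩ := exists_forall_le_const_add hs fun v => pow_nonneg (hlog v) c
    simp only [Set.mem_iUnion]
    refine ⟨c + 2, by omega, mem_DTIME_of_bound hA hNP hF hL fun k =>
      -- From `v ≤ (n + 2) ^ k` follows `logb 2 v ≤ k * logb 2 (n + 2)`, whence the factor `k ^ c`.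
      ⟨fun n => d + k ^ c * Real.logb 2 (n + 2) ^ c, fun n => ?_, fun n v hv => ?_, fun l => ?_⟩⟩
    · have := hlog (n + 2)
      push_cast at this
      positivity
    · refine (hsd v).trans ?_
      have h1 : Real.logb 2 (v : ℝ) ≤ k * Real.logb 2 (n + 2) := by
        rcases Nat.eq_zero_or_pos v with rfl | hv0
        · have := hlog (n + 2)
          push_cast at this
          simp only [Nat.cast_zero, Real.logb_zero]
          positivity
        · rw [← Real.logb_pow]
          exact Real.logb_le_logb_of_le (by norm_num) (by exact_mod_cast hv0)
            (by exact_mod_cast hv)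
      beta_reduce
      rw [← mul_pow]
      have := pow_le_pow_left₀ (hlog v) h1 c
      linarith
    · exact eventually_polylog_le d (k ^ c) hd (by positivity) c l
  · rintro ⟨r, A, -, hr, ⟨hA, hNP⟩, -, hF⟩ L hL
    simp only [Set.mem_iInter]
    intro ε hε
    refine mem_DTIME_of_bound hA hNP hF hL fun k => ?_
    -- With `j > 2 * k / ε`, the `j`-th root of `(n + 2) ^ k` is at most `(n + 2) ^ (ε / 2)`.
    obtain ⟨j, hj⟩ := exists_nat_gt (k / (ε / 2))
    have hj0 : (0 : ℝ) < j := lt_of_le_of_lt (by positivity) hj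
    have hkj : k * (1 / (j : ℝ)) ≤ ε / 2 := by
      rw [div_lt_iff₀ (by positivity)] at hj
      rw [mul_one_div, div_le_iff₀ hj0]
      linarith
    obtain ⟨D, hD, hrD⟩ := (hr j (by exact_mod_cast hj0)).exists_pos
    obtain ⟨d, hd, hrd⟩ := exists_forall_le_const_add
      (b := fun n : ℕ => (r (List.replicate n false) : ℝ))
      (B := fun n => D * (n : ℝ) ^ (1 / (j : ℝ))) (by
        filter_upwards [hrD.bound] with n hn
        rwa [Real.norm_of_nonneg (by positivity), Real.norm_of_nonneg (by positivity)] at hn)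
      fun v => by positivity
    refine ⟨fun n => d + D * ((n : ℝ) + 2) ^ (ε / 2), fun n => by positivity, fun n v hv => ?_,
      fun l => eventually_subpoly_le d D ε hd hD.le hε l⟩
    refine (hrd v).trans ?_
    have hv' : (v : ℝ) ≤ ((n : ℝ) + 2) ^ k := by exact_mod_cast hv
    have : (v : ℝ) ^ (1 / (j : ℝ)) ≤ ((n : ℝ) + 2) ^ (ε / 2) := by
      calc (v : ℝ) ^ (1 / (j : ℝ)) ≤ (((n : ℝ) + 2) ^ k) ^ (1 / (j : ℝ)) := by gcongr
        _ = ((n : ℝ) + 2) ^ (k * (1 / (j : ℝ))) := by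
          rw [← Real.rpow_natCast, ← Real.rpow_mul (by positivity)]
        _ ≤ _ := Real.rpow_le_rpow_of_exponent_le (by linarith [n.cast_nonneg (α := ℝ)]) hkj
    beta_reduce
    gcongr
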